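/- Let $p\ge 2$, $m\ge 1$, $r\ge 0$ be integers, and let ${\bf X}_1,{\bf X}_2,\dots$ be i.i.d. random vectors ${\bf X}_i=({\bf X}_{i,I},{\bf X}_{i,J})\in\mathbb R^p\times\mathbb R^r$ with law $\mathbb P$. Let $A_1,\dots,A_m\subset\mathbb R^r$ be Borel sets with $p_k:=\mathbb P({\bf X}_J\in A_k)>0$ (not necessarily disjoint); put $p_{k,l}:=\mathbb P({\bf X}_J\in A_k\cap A_l)$ and let $\mathbb P_k$ be the law of ${\bf X}$ given ${\bf X}_J\in A_k$. Assume that for all $a\le p$ and $k\le m$ the distribution function of $X_a$ given ${\bf X}_J\in A_k$ is continuous. For $a<b$ let $$\tau_{a,b,k}:=\mathbb P\big((X_{1,a}-X_{2,a})(X_{1,b}-X_{2,b})>0\mid {\bf X}_{1,J},{\bf X}_{2,J}\in A_k\big)-\mathbb P\big((X_{1,a}-X_{2,a})(X_{1,b}-X_{2,b})<0\mid {\bf X}_{1,J},{\bf X}_{2,J}\in A_k\big)$$ be the conditional Kendall's tau. From ${\bf X}_1,\dots,{\bf X}_n$ form $N_k:=\#\{i\le n:{\bf X}_{i,J}\in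 A_k\}$, $w_i^{(k)}:={\bf 1}\{{\bf X}_{i,J}\in A_k\}/N_k$, $s^{(k)}:=\sum_i (w_i^{(k)})^2$, and the empirical conditional Kendall's tau $$\hat\tau_{a,b,k}:=\frac{\hat\tau^{(1)}_{a,b,k}+s^{(k)}}{1-s^{(k)}},\qquad \hat\tau^{(1)}_{a,b,k}:=4\sum_{i,j=1}^n w_i^{(k)}w_j^{(k)}{\bf 1}\{X_{i,a}<X_{j,a},\,X_{i,b}<X_{j,b}\}-1$$ (with the convention $x/0=0$; a zero denominator occurs only when $N_k\le 1$, an event of vanishing probability). Let $\hat{\bf W}$ be the vector of size $mp(p-1)/2$ with entries $\hat\tau_{a,b,k}-\tau_{a,b,k}$, made of one block of length $m$ for each pair $a<b$. Let $T:=[{\bf 1}_{m-1}:-I_{m-1}]$ and $T_e:=I_{p(p-1)/2}\otimes T={\rm Diag}(T,\dots,T)$. Set $$\pi_{a,b}({\bf x},{\bf y}):=\tfrac12\big({\bf 1}\{x_a<y_a,x_b<y_b\}+{\bf 1}\{y_a<x_a,y_b<x_b\}\big),$$ $$D_{a,b,k}:=\mathbb P(X_{1,a}<X_{2,a},X_{1,b}<X_{2,b},{\bf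 X}_{1,J}\in A_k,{\bf X}_{2,J}\in A_k),$$ $$I_{a,b,a',b',k,l}:=\int{\bf 1}\{{\bf x}_{3,J}\in A_k\cap A_l\}\,\pi_{a,b}({\bf x}_1,{\bf x}_3)\,\pi_{a',b'}({\bf x}_2,{\bf x}_3)\,\mathbb P_k(d{\bf x}_1)\,\mathbb P_l(d{\bf x}_2)\,\mathbb P(d{\bf x}_3),$$ $$J_{a,b,k,l}:=\int{\bf 1}\{{\bf x}_{2,J}\in A_k\cap A_l\}\,\pi_{a,b}({\bf x}_1,{\bf x}_2)\,\mathbb P_k(d{\bf x}_1)\,\mathbb P(d{\bf x}_2),$$ and let $\Delta_e$ be the square matrix of size $mp(p-1)/2$ whose entry at $((a,b),k)$, $((a',b'),l)$ is $$64\Big[\frac{I_{a,b,a',b',k,l}}{p_kp_l}+\frac{D_{a,b,k}D_{a',b',l}\,p_{k,l}}{p_k^3p_l^3}-\frac{D_{a',b',l}J_{a,b,k,l}}{p_kp_l^3}-\frac{D_{a,b,k}J_{a',b',l,k}}{p_lp_k^3}\Big].$$ Assume that $T_e\Delta_eT_e'$ is invertible, and that the null hypothesis $\tau_{a,b,1}=\dots=\tau_{a,b,m}$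 holds for all $1\le a<b\le p$. Then, as $n\to\infty$, the statistic $$n\,\hat{\bf W}'T_e'\big(T_e\Delta_eT_e'\big)^{-1}T_e\hat{\bf W}$$ converges in distribution to the chi-squared law with $(m-1)p(p-1)/2$ degrees of freedom (the law of the sum of the squares of that many independent standard normal variables; the point mass at $0$ for zero degrees of freedom). -/

import Mathlib

open MeasureTheory ProbabilityTheory

noncomputable section

namespace CondKendall

/-- An observation `x = (x_I, x_J)`: `p` conditioned coordinates and `r = d - p` conditioning
coordinates. -/
abbrev Obs (p r : ℕ) : Type := (Fin p → ℝ) × (Fin r → ℝ)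

/-- The pairs `(a, b)` with `a < b` of indices of conditioned coordinates. -/
abbrev Pairs (p : ℕ) : Type := {q : Fin p × Fin p // q.1 < q.2}

/-! ### Population quantities -/

section Population

variable {p r m : ℕ}

/-- The event `x_J ∈ B`. -/
def inBox (p : ℕ) {r : ℕ} (B : Set (Fin r → ℝ)) : Set (Obs p r) := {x | x.2 ∈ B}

/-- `P(X_J ∈ B)`. -/
def boxProb (P : Measure (Obs p r)) (B : Set (Fin r → ℝ)) : ℝ := P.real (inBox p B)

/-- The conditional law of `X` given `X_J ∈ B`. -/
def condLaw (P : Measure (Obs p r)) (B : Set (Fin r → ℝ)) : Measure (Obs p r) :=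
  ProbabilityTheory.cond P (inBox p B)

/-- The conditional margin: the law of `X_a` given `X_J ∈ B`. -/
def condMargin (P : Measure (Obs p r)) (B : Set (Fin r → ℝ)) (a : Fin p) : Measure ℝ :=
  (condLaw P B).map (fun x => x.1 a)

/-- Kendall's tau between `X_a` and `X_b` given `X_J ∈ B`: the probability of concordance minus
the probability of discordance of two independent draws from the conditional law. -/
def tau (P : Measure (Obs p r)) (B : Set (Fin r → ℝ)) (a b : Fin p) : ℝ :=
  ((condLaw P B).prod (condLaw P B)).real
      {z | 0 < (z.1.1 a - z.2.1 a) * (z.1.1 b - z.2.1 b)}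
    - ((condLaw P B).prod (condLaw P B)).real
      {z | (z.1.1 a - z.2.1 a) * (z.1.1 b - z.2.1 b) < 0}

/-- `D_{a,b,k} = P(X_{1,a} < X_{2,a}, X_{1,b} < X_{2,b}, X_{1,J} ∈ A_k, X_{2,J} ∈ A_k)`. -/
def D (P : Measure (Obs p r)) (A : Fin m → Set (Fin r → ℝ)) (a b : Fin p) (k : Fin m) : ℝ :=
  (P.prod P).real
    {z | z.1.1 a < z.2.1 a ∧ z.1.1 b < z.2.1 b ∧ z.1.2 ∈ A k ∧ z.2.2 ∈ A k}

/-- `π_{a,b}(x, y)`, half the indicator that `x` and `y` are strictly ordered the same way in both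
coordinates `a` and `b`. -/
def concKernel (a b : Fin p) (x y : Obs p r) : ℝ :=
  ((if x.1 a < y.1 a ∧ x.1 b < y.1 b then 1 else 0)
    + (if y.1 a < x.1 a ∧ y.1 b < x.1 b then 1 else 0)) / 2

/-- `I_{a,b,a',b',k,l}`. The variables are `z.1 = x₁`, `z.2.1 = x₂`, `z.2.2 = x₃`. -/
def bigI (P : Measure (Obs p r)) (A : Fin m → Set (Fin r → ℝ)) (a b a' b' : Fin p)
    (k l : Fin m) : ℝ :=
  ∫ z, (inBox p (A k ∩ A l)).indicator 1 z.2.2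
      * concKernel a b z.1 z.2.2 * concKernel a' b' z.2.1 z.2.2
    ∂((condLaw P (A k)).prod ((condLaw P (A l)).prod P))

/-- `J_{a,b,k,l}`. The variables are `z.1 = x₁`, `z.2 = x₂`. -/
def bigJ (P : Measure (Obs p r)) (A : Fin m → Set (Fin r → ℝ)) (a b : Fin p) (k l : Fin m) : ℝ :=
  ∫ z, (inBox p (A k ∩ A l)).indicator 1 z.2 * concKernel a b z.1 z.2
    ∂((condLaw P (A k)).prod P)

/-- The asymptotic covariance matrix `Δ_e`, with rows and columns indexed by a pair `(a, b)` (the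
block) and an index `k` of a conditioning set. -/
def Delta (P : Measure (Obs p r)) (A : Fin m → Set (Fin r → ℝ)) :
    Matrix (Pairs p × Fin m) (Pairs p × Fin m) ℝ :=
  Matrix.of fun s t =>
    let a := s.1.1.1
    let b := s.1.1.2
    let k := s.2
    let a' := t.1.1.1
    let b' := t.1.1.2
    let l := t.2
    let pk := boxProb P (A k)
    let pl := boxProb P (A l)
    let pkl := boxProb P (A k ∩ A l)
    64 * (bigI P A a b a' b' k l / (pk * pl)
      + D P A a b k * D P A a' b' l * pkl / (pk ^ 3 * pl ^ 3)
      - D P A a' b' l * bigJ P A a b k l / (pk * pl ^ 3)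
      - D P A a b k * bigJ P A a' b' l k / (pl * pk ^ 3))

end Population

/-! ### The contrast matrix -/

/-- `T = [1_{m-1} : -I_{m-1}]`. -/
def contrast (m : ℕ) : Matrix (Fin (m - 1)) (Fin m) ℝ :=
  Matrix.of fun i j => if j.val = 0 then 1 else if j.val = i.val + 1 then -1 else 0

/-- `T_e = I_{p(p-1)/2} ⊗ T`. -/
def contrastE (p m : ℕ) : Matrix (Pairs p × Fin (m - 1)) (Pairs p × Fin m) ℝ :=
  Matrix.kronecker (1 : Matrix (Pairs p) (Pairs p) ℝ) (contrast m)

/-! ### Sample quantities, for a sample `x` of size `n` -/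

section Sample

variable {p r m n : ℕ}

/-- The size `N_{k,n}` of the subsample with `x_{i,J} ∈ B`. -/
def subSize (x : Fin n → Obs p r) (B : Set (Fin r → ℝ)) : ℝ :=
  ∑ i, (inBox p B).indicator 1 (x i)

/-- The weight `w_{i,n} = 1{x_{i,J} ∈ B} / N`. -/
def weight (x : Fin n → Obs p r) (B : Set (Fin r → ℝ)) (i : Fin n) : ℝ :=
  (inBox p B).indicator 1 (x i) / subSize x B

/-- `s_n = ∑ w_{i,n}²`. -/
def sumSqWeight (x : Fin n → Obs p r) (B : Set (Fin r → ℝ)) : ℝ :=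
  ∑ i, weight x B i ^ 2

/-- The first estimator of the conditional Kendall's tau. -/
def tauHat1 (x : Fin n → Obs p r) (B : Set (Fin r → ℝ)) (a b : Fin p) : ℝ :=
  4 * (∑ i, ∑ j, weight x B i * weight x B j
    * (if (x i).1 a < (x j).1 a ∧ (x i).1 b < (x j).1 b then 1 else 0)) - 1

/-- The empirical conditional Kendall's tau, a rescaling of the first estimator. -/
def tauHat (x : Fin n → Obs p r) (B : Set (Fin r → ℝ)) (a b : Fin p) : ℝ :=
  tauHat1 x B a b / (1 - sumSqWeight x B) + sumSqWeight x B / (1 - sumSqWeight x B)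

/-- The stacked vector `Ŵ` of the estimation errors of all conditional Kendall's taus. -/
def W (P : Measure (Obs p r)) (A : Fin m → Set (Fin r → ℝ)) (x : Fin n → Obs p r) :
    Pairs p × Fin m → ℝ :=
  fun s => tauHat x (A s.2) s.1.1.1 s.1.1.2 - tau P (A s.2) s.1.1.1 s.1.1.2

/-- The Wald-type statistic `n Ŵ' T_e' (T_e Δ_e T_e')⁻¹ T_e Ŵ`. -/
def waldStat (P : Measure (Obs p r)) (A : Fin m → Set (Fin r → ℝ)) (x : Fin n → Obs p r) : ℝ :=
  let T := contrastE p m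
  n * (T.mulVec (W P A x) ⬝ᵥ (T * Delta P A * T.transpose)⁻¹.mulVec (T.mulVec (W P A x)))

end Sample

/-! ### The chi-squared distribution -/

/-- The chi-squared distribution with `N` degrees of freedom: the law of the sum of the squares of
`N` independent standard Gaussian variables. -/
def chiSquared (N : ℕ) : Measure ℝ :=
  (Measure.pi fun _ : Fin N => gaussianReal 0 1).map (fun z => ∑ i, z i ^ 2)

instance (N : ℕ) : IsProbabilityMeasure (chiSquared N) :=
  Measure.isProbabilityMeasure_map
    (Finset.measurable_sum _ fun i _ => (measurable_pi_apply i).pow_const 2).aemeasurable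

end CondKendall

end

/-! Write `θ` for `condConc`, the conditional probability of being smaller in both coordinates.
Without ties concordance and discordance exhaust all mass, so `τ = 4θ - 1` (`tau_eq`). The sum of
squared weights is `1/N`, and the rescaling in `tauHat` turns the error `τ̂ - τ` into exactly
`4/(N(N-1))` times the sum over `i ≠ j` of `tauKernel` (`W_eq`). Because `θ` is subtracted inside
the indicators, this kernel has mean zero under `P`, and the random subsample size `N` enters only
through the prefactor.

Hence `√n Ŵ` is, entry by entry, `sizeRatio * uStat`: `uStat` is a U-statistic with deterministic
normalization, and `sizeRatio` tends to `1` almost surely by the strong law. The Hájek projection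
(`hajek_remainder`) replaces `uStat` by a normalized i.i.d. sum of `score` vectors, with an error of
order `1/√n` in `L²`. The scores are bounded and centered and their covariance is `Delta`
(`integral_score_mul_score`), so the multivariate central limit theorem gives the limit `N(0, Δ_e)`.

The Wald statistic is a continuous function of `(uStat, sizeRatio)` outside small subsamples.
Slutsky's lemma gives convergence to the quadratic form of `T_e Z` in the inverse of its own
covariance, with `Z` of law `N(0, Δ_e)`. This form is the squared length of a standard Gaussian
vector (`multivariateGaussian_map_quadForm`). -/

namespace CondKendall

open Filter Topology
open scoped Matrix

/-! ### Gaussian limits and quadratic forms. -/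

section Gaussian

variable {ι κ : Type*} [Fintype ι] [Fintype κ]

theorem inner_eq_sum (x t : EuclideanSpace ℝ ι) : inner ℝ x t = ∑ s, t s * x s := by
  simp [PiLp.inner_apply]

/-- **Multivariate central limit theorem.** -/
theorem tendstoInDistribution_multivariateGaussian [DecidableEq ι]
    {Ω : Type*} {mΩ : MeasurableSpace Ω}
    {Q : Measure Ω} [IsProbabilityMeasure Q] {S : Matrix ι ι ℝ} (hS : S.PosSemidef)
    {V : ℕ → Ω → EuclideanSpace ℝ ι} (hindep : iIndepFun V Q)
    (hident : ∀ i, IdentDistrib (V i) (V 0) Q Q)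
    (hL2 : ∀ s, MemLp (fun ω => V 0 ω s) 2 Q)
    (hmean : ∀ s, ∫ ω, V 0 ω s ∂Q = 0)
    (hcov : ∀ s t, ∫ ω, V 0 ω s * V 0 ω t ∂Q = S s t) :
    TendstoInDistribution (fun (n : ℕ) ω => (√n)⁻¹ • ∑ k ∈ Finset.range n, V k ω) atTop id
      (fun _ => Q) (multivariateGaussian 0 S) where
  forall_aemeasurable n :=
    (Finset.aemeasurable_fun_sum (f := V) (Finset.range n)
      fun _ _ => (hident _).aemeasurable_fst).const_smul (√n)⁻¹
  aemeasurable_limit := aemeasurable_id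
  tendsto := by
    have hVm : ∀ i, AEMeasurable (V i) Q := fun i => (hident i).aemeasurable_fst
    refine ProbabilityMeasure.tendsto_iff_tendsto_charFun.2 fun t => ?_
    have hint : Measurable (fun x : EuclideanSpace ℝ ι => inner ℝ x t) := by fun_prop
    -- Cramér–Wold: the characteristic function of the vector sum at `t` is that of the sum of the
    -- scalars `⟪V i, t⟫` at `1`, so the scalar central limit theorem suffices.
    let Y : ℕ → Ω → ℝ := fun i ω => inner ℝ (V i ω) t
    have hYindep : iIndepFun Y Q := hindep.comp (fun _ x => inner ℝ x t) fun _ => hint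
    have hYident : ∀ i, IdentDistrib (Y i) (Y 0) Q Q := fun i => (hident i).comp hint
    have hY0 : Y 0 = fun ω => ∑ s, t s * V 0 ω s := by
      ext ω; exact inner_eq_sum _ _
    have hYL2 : MemLp (Y 0) 2 Q := by
      rw [hY0]
      exact memLp_finsetSum _ fun s _ => (hL2 s).const_mul _
    have hYmean : ∫ ω, Y 0 ω ∂Q = 0 := by
      rw [hY0, integral_finsetSum _ fun s _ => ((hL2 s).integrable (by norm_num)).const_mul _]
      simp [integral_const_mul, hmean]
    have hYvar : Var[Y 0; Q] = t ⬝ᵥ S *ᵥ t := by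
      rw [variance_eq_integral hYL2.aestronglyMeasurable.aemeasurable, hYmean]
      have : ∀ ω, (Y 0 ω - 0) ^ 2 = ∑ s, ∑ u, (t s * t u) * (V 0 ω s * V 0 ω u) := by
        intro ω
        rw [hY0, sub_zero, sq, Finset.sum_mul_sum]
        exact Finset.sum_congr rfl fun s _ => Finset.sum_congr rfl fun u _ => by ring
      simp_rw [this]
      have hi : ∀ s u, Integrable (fun ω => (t s * t u) * (V 0 ω s * V 0 ω u)) Q :=
        fun s u => ((hL2 s).integrable_mul (hL2 u)).const_mul _
      rw [integral_finsetSum _ fun s _ => integrable_finsetSum _ fun u _ => hi s u]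
      simp only [dotProduct, Matrix.mulVec, Finset.mul_sum]
      refine Finset.sum_congr rfl fun s _ => ?_
      rw [integral_finsetSum _ fun u _ => hi s u]
      exact Finset.sum_congr rfl fun u _ => by rw [integral_const_mul, hcov]; ring
    have hclt := tendstoInDistribution_inv_sqrt_mul_sum_sub (Y := id)
      (P' := gaussianReal 0 Var[Y 0; Q].toNNReal) ⟨aemeasurable_id, Measure.map_id⟩ hYL2 hYindep
      hYident
    have hlim := ProbabilityMeasure.tendsto_iff_tendsto_charFun.1 hclt.tendsto 1
    simp only [ProbabilityMeasure.coe_mk, Measure.map_id, charFun_multivariateGaussian hS,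
      charFun_gaussianReal, hYmean] at hlim ⊢
    have hlimit : Complex.exp (((1 : ℝ) : ℂ) * ((0 : ℝ) : ℂ) * Complex.I
        - ((Var[Y 0; Q].toNNReal : ℝ) : ℂ) * ((1 : ℝ) : ℂ) ^ 2 / 2)
        = Complex.exp ((inner ℝ t (0 : EuclideanSpace ℝ ι) : ℝ) * Complex.I
          - ((t ⬝ᵥ S *ᵥ t : ℝ) : ℂ) / 2) := by
      rw [Real.coe_toNNReal _ (variance_nonneg _ _), hYvar]
      simp
    rw [← hlimit]
    refine hlim.congr fun n => ?_
    have hsum : AEMeasurable (fun ω => ∑ k ∈ Finset.range n, V k ω) Q :=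
      Finset.aemeasurable_fun_sum _ fun _ _ => hVm _
    have hsmul : AEMeasurable (fun ω => (√n)⁻¹ • ∑ k ∈ Finset.range n, V k ω) Q :=
      hsum.const_smul (√n)⁻¹
    have hsumY : AEMeasurable (fun ω => ∑ k ∈ Finset.range n, Y k ω) Q :=
      Finset.aemeasurable_fun_sum _ fun _ _ => (hYident _).aemeasurable_fst
    rw [charFun_apply, charFun_apply, integral_map (by fun_prop) (by fun_prop),
      integral_map hsmul (by fun_prop)]
    refine integral_congr_ae (ae_of_all _ fun ω => ?_)
    simp [Y, real_inner_smul_left, sum_inner]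

/-- The quadratic form that standardizes a linear image of a Gaussian vector is distributed as the
squared length of a standard Gaussian vector. -/
theorem multivariateGaussian_map_quadForm [DecidableEq ι] [DecidableEq κ] {S : Matrix ι ι ℝ}
    (hS : S.PosSemidef) (M : Matrix κ ι ℝ) (hM : IsUnit (M * S * Mᵀ)) :
    (multivariateGaussian 0 S).map
        (fun x : EuclideanSpace ℝ ι => (M *ᵥ x) ⬝ᵥ (M * S * Mᵀ)⁻¹ *ᵥ (M *ᵥ x))
      = (Measure.pi fun _ : κ => gaussianReal 0 1).map (fun z => ∑ i, z i ^ 2) := by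
  have hC : (M * S * Mᵀ).PosSemidef := by
    simpa [Matrix.conjTranspose_eq_transpose_of_trivial] using hS.mul_mul_conjTranspose_same M
  -- Whitening: `R` is the symmetric square root of the inverse covariance of `M x`, so `R M x` has
  -- identity covariance. Only `M S Mᵀ` has to be invertible; `S` itself may be singular.
  obtain ⟨R, hRsymm, hR⟩ : ∃ R : Matrix κ κ ℝ, Rᵀ = R ∧ R * R = (M * S * Mᵀ)⁻¹ := by
    open scoped MatrixOrder in
    refine ⟨CFC.sqrt (M * S * Mᵀ)⁻¹, ?_, CFC.sqrt_mul_sqrt_self _ hC.inv.nonneg⟩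
    open scoped MatrixOrder in
    have := (CFC.sqrt_nonneg (M * S * Mᵀ)⁻¹).isSelfAdjoint.star_eq
    rwa [Matrix.star_eq_conjTranspose, Matrix.conjTranspose_eq_transpose_of_trivial] at this
  have hdet : IsUnit (M * S * Mᵀ).det := (Matrix.isUnit_iff_isUnit_det _).1 hM
  have hone : R * (M * S * Mᵀ) * R = 1 := by
    rw [mul_eq_one_comm, ← mul_assoc, hR, Matrix.nonsing_inv_mul _ hdet]
  let L : EuclideanSpace ℝ ι →L[ℝ] EuclideanSpace ℝ κ :=
    LinearMap.toContinuousLinearMap (Matrix.toLpLin 2 2 (R * M))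
  have hL : ∀ x, (L x : κ → ℝ) = R *ᵥ (M *ᵥ x) := by
    intro x
    simp [L, Matrix.toLpLin_apply, Matrix.mulVec_mulVec]
  have hmap : (multivariateGaussian 0 S).map L = stdGaussian (EuclideanSpace ℝ κ) := by
    have : IsProbabilityMeasure ((multivariateGaussian 0 S).map L) :=
      Measure.isProbabilityMeasure_map (by fun_prop)
    refine Measure.ext_of_charFun (funext fun t => ?_)
    have hadj : charFun ((multivariateGaussian 0 S).map L) t
        = charFun (multivariateGaussian 0 S) (WithLp.toLp 2 ((R * M)ᵀ *ᵥ t)) := by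
      rw [charFun_apply, charFun_apply, integral_map (by fun_prop) (by fun_prop)]
      refine integral_congr_ae (ae_of_all _ fun x => ?_)
      have : inner ℝ (L x) t = inner ℝ x (WithLp.toLp 2 ((R * M)ᵀ *ᵥ t)) := by
        rw [inner_eq_sum, inner_eq_sum]
        change (t : κ → ℝ) ⬝ᵥ (L x) = ((R * M)ᵀ *ᵥ t) ⬝ᵥ x
        rw [hL, Matrix.mulVec_mulVec, Matrix.dotProduct_mulVec, Matrix.mulVec_transpose]
      simp only [this]
    rw [hadj, charFun_multivariateGaussian hS, charFun_stdGaussian]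
    have hq : ((R * M)ᵀ *ᵥ t) ⬝ᵥ S *ᵥ ((R * M)ᵀ *ᵥ t) = ‖t‖ ^ 2 := by
      rw [Matrix.mulVec_transpose, ← Matrix.dotProduct_mulVec, Matrix.mulVec_mulVec,
        ← Matrix.mulVec_transpose, Matrix.mulVec_mulVec, Matrix.transpose_mul, hRsymm,
        show R * M * S * (Mᵀ * R) = R * (M * S * Mᵀ) * R by simp only [Matrix.mul_assoc], hone,
        Matrix.one_mulVec, EuclideanSpace.real_norm_sq_eq]
      simp [dotProduct, sq]
    simp only [hq, inner_zero_right]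
    congr 1
    push_cast
    ring
  -- With `R` symmetric and `R * R` the inverse covariance, the quadratic form is `‖R M x‖²`.
  have hfun : (fun x : EuclideanSpace ℝ ι => (M *ᵥ x) ⬝ᵥ (M * S * Mᵀ)⁻¹ *ᵥ (M *ᵥ x))
      = (fun y : EuclideanSpace ℝ κ => ∑ i, y i ^ 2) ∘ L := by
    ext x
    rw [Function.comp_apply, ← hR, ← Matrix.mulVec_mulVec, Matrix.dotProduct_mulVec,
      ← Matrix.mulVec_transpose, hRsymm, ← hL]
    simp [dotProduct, sq]
  rw [hfun, ← Measure.map_map (by fun_prop) (by fun_prop), hmap, ← map_pi_eq_stdGaussian,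
    Measure.map_map (by fun_prop) (by fun_prop)]
  rfl

theorem map_sum_sq_eq_chiSquared {N : ℕ} (hN : Fintype.card κ = N) :
    (Measure.pi fun _ : κ => gaussianReal 0 1).map (fun z => ∑ i, z i ^ 2) = chiSquared N := by
  let e : Fin N ≃ κ := (Fintype.equivFinOfCardEq hN).symm
  rw [chiSquared, ← (measurePreserving_piCongrLeft (fun _ : κ => gaussianReal 0 1) e).map_eq,
    Measure.map_map (by fun_prop) (by fun_prop)]
  congr 1
  ext z
  simp only [Function.comp_apply]
  rw [← e.sum_comp]
  simp [MeasurableEquiv.coe_piCongrLeft]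

end Gaussian

/-! ### U-statistics of order two and their Hájek projection. -/

theorem sum_offDiag_eq (S : Finset ℕ) (F : ℕ → ℕ → ℝ) :
    ∑ q ∈ S.offDiag, F q.1 q.2 = ∑ i ∈ S, ∑ j ∈ S, F i j - ∑ i ∈ S, F i i := by
  have h := Finset.sum_product (s := S) (t := S) (f := fun q : ℕ × ℕ => F q.1 q.2)
  rw [← Finset.diag_union_offDiag, Finset.sum_union (Finset.disjoint_diag_offDiag _),
    Finset.sum_diag] at h
  linarith

section UStatistic

variable {Ω E : Type*} {mΩ : MeasurableSpace Ω} {mE : MeasurableSpace E} {Q : Measure Ω}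
  {P : Measure E} {X : ℕ → Ω → E}

theorem integrable_of_abs_le {μ : Measure E} [IsFiniteMeasure μ] {f : E → ℝ}
    (hf : AEMeasurable f μ) {C : ℝ} (hC : ∀ x, |f x| ≤ C) : Integrable f μ :=
  Integrable.of_bound hf.aestronglyMeasurable C (ae_of_all _ hC)

/-- Only `i` has to differ from the others; `j`, `k`, `l` may coincide, which the second-moment
expansion requires. -/
theorem indepFun_triple (hX : ∀ i, AEMeasurable (X i) Q) (hindep : iIndepFun X Q) {i j k l : ℕ}
    (hij : i ≠ j) (hik : i ≠ k) (hil : i ≠ l) :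
    IndepFun (X i) (fun ω => (X j ω, X k ω, X l ω)) Q := by
  have h := hindep.indepFun_finset₀ {i} {j, k, l} (by simp [hij, hik, hil]) hX
  have h1 : Measurable fun z : (({i} : Finset ℕ) → E) => z ⟨i, by simp⟩ := measurable_pi_apply _
  have h2 : Measurable fun z : (({j, k, l} : Finset ℕ) → E) =>
      (z ⟨j, by simp⟩, z ⟨k, by simp⟩, z ⟨l, by simp⟩) :=
    (measurable_pi_apply _).prodMk ((measurable_pi_apply _).prodMk (measurable_pi_apply _))
  exact h.comp h1 h2

variable [IsProbabilityMeasure Q] [IsProbabilityMeasure P]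

/-- Since `X i` is independent of the other three variables jointly, it can be integrated out first,
and degeneracy of `f` in its first argument kills the product. -/
theorem integral_mul_eq_zero_of_degenerate (hlaw : ∀ i, HasLaw (X i) P Q)
    (hindep : iIndepFun X Q) {f h : E → E → ℝ} {C : ℝ}
    (hf : Measurable (Function.uncurry f)) (hfC : ∀ x y, |f x y| ≤ C)
    (hh : Measurable (Function.uncurry h)) (hhC : ∀ x y, |h x y| ≤ C)
    (hf0 : ∀ y, ∫ x, f x y ∂P = 0) {i j k l : ℕ} (hij : i ≠ j) (hik : i ≠ k) (hil : i ≠ l) :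
    ∫ ω, f (X i ω) (X j ω) * h (X k ω) (X l ω) ∂Q = 0 := by
  have hX : ∀ i, AEMeasurable (X i) Q := fun i => (hlaw i).aemeasurable
  have hY : AEMeasurable (fun ω => (X j ω, X k ω, X l ω)) Q :=
    (hX j).prodMk ((hX k).prodMk (hX l))
  have hind := indepFun_triple hX hindep hij hik hil
  rw [indepFun_iff_map_prod_eq_prod_map_map (hX i) hY, (hlaw i).map_eq] at hind
  have : IsProbabilityMeasure (Q.map fun ω => (X j ω, X k ω, X l ω)) :=
    Measure.isProbabilityMeasure_map hY
  let F : E × E × E × E → ℝ := fun z => f z.1 z.2.1 * h z.2.2.1 z.2.2.2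
  have hF : Measurable F :=
    (hf.comp (measurable_fst.prodMk (measurable_fst.comp measurable_snd))).mul
      (hh.comp (measurable_snd.comp measurable_snd))
  have hFC : ∀ z, |F z| ≤ C * C := fun z => by
    rw [abs_mul]
    exact mul_le_mul (hfC _ _) (hhC _ _) (abs_nonneg _) ((abs_nonneg _).trans (hfC z.1 z.1))
  change ∫ ω, F (X i ω, X j ω, X k ω, X l ω) ∂Q = 0
  rw [← integral_map (f := F) ((hX i).prodMk hY) hF.aestronglyMeasurable, hind,
    integral_prod_symm _ (integrable_of_abs_le hF.aemeasurable hFC)]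
  simp [F, integral_mul_const, hf0]

/-- The second moment of a completely degenerate U-statistic with bounded kernel. -/
theorem integral_sq_sum_offDiag_le (hlaw : ∀ i, HasLaw (X i) P Q)
    (hindep : iIndepFun X Q) {f : E → E → ℝ} {C : ℝ}
    (hf : Measurable (Function.uncurry f)) (hfC : ∀ x y, |f x y| ≤ C)
    (hf1 : ∀ y, ∫ x, f x y ∂P = 0) (hf2 : ∀ x, ∫ y, f x y ∂P = 0) (n : ℕ) :
    ∫ ω, (∑ q ∈ (Finset.range n).offDiag, f (X q.1 ω) (X q.2 ω)) ^ 2 ∂Q ≤ 2 * C ^ 2 * n ^ 2 := by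
  classical
  have hX : ∀ i, AEMeasurable (X i) Q := fun i => (hlaw i).aemeasurable
  have hC : ∀ q q' : ℕ × ℕ, ∀ ω, |f (X q.1 ω) (X q.2 ω) * f (X q'.1 ω) (X q'.2 ω)| ≤ C ^ 2 := by
    intro q q' ω
    rw [abs_mul, sq]
    exact mul_le_mul (hfC _ _) (hfC _ _) (abs_nonneg _) ((abs_nonneg _).trans (hfC (X 0 ω) (X 0 ω)))
  have hm : ∀ q : ℕ × ℕ, AEMeasurable (fun ω => f (X q.1 ω) (X q.2 ω)) Q := fun q =>
    hf.comp_aemeasurable ((hX q.1).prodMk (hX q.2))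
  have hint : ∀ q q' : ℕ × ℕ,
      Integrable (fun ω => f (X q.1 ω) (X q.2 ω) * f (X q'.1 ω) (X q'.2 ω)) Q := fun q q' =>
    integrable_of_abs_le ((hm q).mul (hm q')) (hC q q')
  have hle : ∀ q q' : ℕ × ℕ, ∫ ω, f (X q.1 ω) (X q.2 ω) * f (X q'.1 ω) (X q'.2 ω) ∂Q ≤ C ^ 2 := by
    intro q q'
    calc _ ≤ ∫ _, C ^ 2 ∂Q :=
          integral_mono (hint q q') (integrable_const _) fun ω => (le_abs_self _).trans (hC q q' ω)
      _ = C ^ 2 := by simp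
  -- Two products of kernels are correlated only if they use the same two indices. Otherwise some
  -- index of `q` is absent from `q'`, and it can be integrated out.
  have hzero : ∀ q ∈ (Finset.range n).offDiag, ∀ q' ∈ (Finset.range n).offDiag,
      q' ∉ ({q, q.swap} : Finset (ℕ × ℕ)) →
      ∫ ω, f (X q.1 ω) (X q.2 ω) * f (X q'.1 ω) (X q'.2 ω) ∂Q = 0 := by
    rintro ⟨i, j⟩ hq ⟨k, l⟩ hq' hne
    simp only [Finset.mem_offDiag, Finset.mem_insert, Finset.mem_singleton, Prod.swap_prod_mk,
      Prod.mk.injEq, not_or] at hq hq' hne ⊢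
    by_cases hi : i ≠ k ∧ i ≠ l
    · exact integral_mul_eq_zero_of_degenerate hlaw hindep hf hfC hf hfC hf1 hq.2.2 hi.1 hi.2
    -- If `i` occurs in `q'`, then `j` cannot, since `q'` is neither `q` nor its swap; the
    -- degeneracy in the second argument is used.
    · have hj : j ≠ k ∧ j ≠ l := by grind
      exact integral_mul_eq_zero_of_degenerate (f := fun x y => f y x) hlaw hindep
        (hf.comp measurable_swap) (fun x y => hfC y x) hf hfC hf2 hq.2.2.symm hj.1 hj.2
  have hsq : ∀ ω, (∑ q ∈ (Finset.range n).offDiag, f (X q.1 ω) (X q.2 ω)) ^ 2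
      = ∑ q ∈ (Finset.range n).offDiag, ∑ q' ∈ (Finset.range n).offDiag,
        f (X q.1 ω) (X q.2 ω) * f (X q'.1 ω) (X q'.2 ω) := fun ω => by
    rw [sq, Finset.sum_mul_sum]
  simp_rw [hsq]
  rw [integral_finsetSum _ fun q _ => integrable_finsetSum _ fun q' _ => hint q q']
  have hrow : ∀ q ∈ (Finset.range n).offDiag,
      ∫ ω, ∑ q' ∈ (Finset.range n).offDiag, f (X q.1 ω) (X q.2 ω) * f (X q'.1 ω) (X q'.2 ω) ∂Q
        ≤ 2 * C ^ 2 := by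
    intro q hq
    rw [integral_finsetSum _ fun q' _ => hint q q']
    have hsub : ({q, q.swap} : Finset (ℕ × ℕ)) ⊆ (Finset.range n).offDiag := by
      intro z hz
      simp only [Finset.mem_offDiag, Finset.mem_insert, Finset.mem_singleton] at hq hz ⊢
      rcases hz with rfl | rfl
      · exact hq
      · exact ⟨hq.2.1, hq.1, hq.2.2.symm⟩
    rw [← Finset.sum_subset hsub fun q' hq' hne => hzero q hq q' hq' hne]
    calc _ ≤ ∑ _ ∈ ({q, q.swap} : Finset (ℕ × ℕ)), C ^ 2 := Finset.sum_le_sum fun q' _ => hle q q'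
      _ ≤ 2 * C ^ 2 := by
        rw [Finset.sum_const, nsmul_eq_mul]
        gcongr
        exact_mod_cast Finset.card_le_two
  calc _ ≤ ∑ _ ∈ (Finset.range n).offDiag, 2 * C ^ 2 := Finset.sum_le_sum hrow
    _ ≤ n ^ 2 * (2 * C ^ 2) := by
      rw [Finset.sum_const, nsmul_eq_mul]
      gcongr
      rw [Finset.offDiag_card, Finset.card_range, sq]
      exact_mod_cast Nat.sub_le _ _
    _ = _ := by ring

/-- Chebyshev's inequality. -/
theorem tendstoInMeasure_zero_of_tendsto_integral_sq {F : Type*} [NormedAddCommGroup F]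
    {f : ℕ → Ω → F} (hf : ∀ n, Integrable (fun ω => ‖f n ω‖ ^ 2) Q)
    (h : Tendsto (fun n => ∫ ω, ‖f n ω‖ ^ 2 ∂Q) atTop (𝓝 0)) :
    TendstoInMeasure Q f atTop 0 := by
  rw [tendstoInMeasure_iff_measureReal_norm]
  intro ε hε
  have hlim : Tendsto (fun n => (∫ ω, ‖f n ω‖ ^ 2 ∂Q) / ε ^ 2) atTop (𝓝 0) := by
    simpa using h.div_const (ε ^ 2)
  refine squeeze_zero (fun n => measureReal_nonneg) (fun n => ?_) hlim
  rw [le_div_iff₀ (by positivity), mul_comm]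
  refine le_trans (mul_le_mul_of_nonneg_left (measureReal_mono fun ω hω => ?_) (by positivity))
    (mul_meas_ge_le_integral_of_nonneg (ae_of_all _ fun ω => by positivity) (hf n) (ε ^ 2))
  simp only [Set.mem_ofPred_eq, Pi.zero_apply, sub_zero] at hω ⊢
  gcongr

/-- The remainder in the Hájek projection of a U-statistic with bounded symmetric kernel. -/
theorem hajek_remainder (hlaw : ∀ i, HasLaw (X i) P Q) (hindep : iIndepFun X Q)
    {g : E → E → ℝ} {C : ℝ} (hg : Measurable (Function.uncurry g)) (hgC : ∀ x y, |g x y| ≤ C)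
    (hsymm : ∀ x y, g x y = g y x) (h0 : ∫ x, ∫ y, g x y ∂P ∂P = 0) :
    let r : ℕ → Ω → ℝ := fun n ω =>
      ((n : ℝ) * √n)⁻¹ * ∑ q ∈ (Finset.range n).offDiag, g (X q.1 ω) (X q.2 ω)
        - (√n)⁻¹ * ∑ i ∈ Finset.range n, 2 * ∫ y, g (X i ω) y ∂P
    (∀ n, Integrable (fun ω => r n ω ^ 2) Q) ∧
      Tendsto (fun n => ∫ ω, r n ω ^ 2 ∂Q) atTop (𝓝 0) := by
  intro r
  have hX : ∀ i, AEMeasurable (X i) Q := fun i => (hlaw i).aemeasurable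
  let g₁ : E → ℝ := fun x => ∫ y, g x y ∂P
  have hg₁ : Measurable g₁ :=
    (StronglyMeasurable.integral_prod_right hg.stronglyMeasurable).measurable
  have hgi : ∀ x, Integrable (g x) P := fun x =>
    integrable_of_abs_le (hg.comp measurable_prodMk_left).aemeasurable (hgC x)
  have hg₁C : ∀ x, |g₁ x| ≤ C := fun x => by
    simpa using norm_integral_le_of_norm_le_const (μ := P) (f := g x) (ae_of_all _ (hgC x))
  have hg₁i : Integrable g₁ P := integrable_of_abs_le hg₁.aemeasurable hg₁C
  -- The Hoeffding decomposition: removing both projections leaves a kernel that is degenerate in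
  -- each argument.
  let f : E → E → ℝ := fun x y => g x y - g₁ x - g₁ y
  have hf : Measurable (Function.uncurry f) :=
    (hg.sub (hg₁.comp measurable_fst)).sub (hg₁.comp measurable_snd)
  have hfC : ∀ x y, |f x y| ≤ 3 * C := fun x y => by
    have h1 := abs_le.1 (hgC x y)
    have h2 := abs_le.1 (hg₁C x)
    have h3 := abs_le.1 (hg₁C y)
    exact abs_le.2 ⟨by simp only [f]; linarith, by simp only [f]; linarith⟩
  have hf2 : ∀ x, ∫ y, f x y ∂P = 0 := fun x => by
    simp only [f]
    have hi : Integrable (fun y => g x y - g₁ x) P := (hgi x).sub (integrable_const _)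
    rw [integral_sub hi hg₁i, integral_sub (hgi x) (integrable_const _), h0]
    simp [g₁]
  have hf1 : ∀ y, ∫ x, f x y ∂P = 0 := fun y => by
    rw [← hf2 y]
    exact integral_congr_ae (ae_of_all _ fun x => by simp only [f, hsymm x y]; ring)
  -- Each index lies in `n - 1` ordered pairs on either side, whereas the projection term counts it
  -- `n` times; the mismatch is the extra `2 ∑ g₁`.
  have hsum : ∀ (n : ℕ) ω, r n ω = ((n : ℝ) * √n)⁻¹ *
      (∑ q ∈ (Finset.range n).offDiag, f (X q.1 ω) (X q.2 ω)
        - 2 * ∑ i ∈ Finset.range n, g₁ (X i ω)) := by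
    intro n ω
    rcases Nat.eq_zero_or_pos n with rfl | hn
    · simp [r]
    have hn' : (n : ℝ) ≠ 0 := by positivity
    have hfst : ∑ q ∈ (Finset.range n).offDiag, g₁ (X q.1 ω)
        = (n - 1) * ∑ i ∈ Finset.range n, g₁ (X i ω) := by
      rw [sum_offDiag_eq _ fun i _ => g₁ (X i ω)]
      simp only [Finset.sum_const, Finset.card_range, nsmul_eq_mul, ← Finset.mul_sum]
      ring
    have hsnd : ∑ q ∈ (Finset.range n).offDiag, g₁ (X q.2 ω)
        = (n - 1) * ∑ i ∈ Finset.range n, g₁ (X i ω) := by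
      rw [sum_offDiag_eq _ fun _ j => g₁ (X j ω)]
      simp only [Finset.sum_const, Finset.card_range, nsmul_eq_mul]
      ring
    simp only [f, Finset.sum_sub_distrib, hfst, hsnd, r, ← Finset.mul_sum]
    field_simp
    ring
  have hfm : ∀ n, AEMeasurable
      (fun ω => ∑ q ∈ (Finset.range n).offDiag, f (X q.1 ω) (X q.2 ω)) Q := fun n =>
    Finset.aemeasurable_fun_sum _ fun q _ => hf.comp_aemeasurable ((hX q.1).prodMk (hX q.2))
  have hgm : ∀ n, AEMeasurable (fun ω => ∑ i ∈ Finset.range n, g₁ (X i ω)) Q := fun n =>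
    Finset.aemeasurable_fun_sum _ fun i _ => hg₁.comp_aemeasurable (hX i)
  have hfb : ∀ (n : ℕ) ω, |∑ q ∈ (Finset.range n).offDiag, f (X q.1 ω) (X q.2 ω)|
      ≤ (Finset.range n).offDiag.card * (3 * C) := fun n ω => by
    rw [← nsmul_eq_mul]
    exact (Finset.abs_sum_le_sum_abs _ _).trans (Finset.sum_le_card_nsmul _ _ _ fun q _ => hfC _ _)
  have hgb : ∀ (n : ℕ) ω, |∑ i ∈ Finset.range n, g₁ (X i ω)| ≤ n * C := fun n ω => by
    simpa using (Finset.abs_sum_le_sum_abs _ _).trans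
      (Finset.sum_le_card_nsmul (Finset.range n) _ _ fun i _ => hg₁C (X i ω))
  have hfint : ∀ n, Integrable
      (fun ω => (∑ q ∈ (Finset.range n).offDiag, f (X q.1 ω) (X q.2 ω)) ^ 2) Q := fun n =>
    integrable_of_abs_le ((hfm n).pow_const 2) fun ω => by
      rw [abs_pow]; exact pow_le_pow_left₀ (abs_nonneg _) (hfb n ω) 2
  have hle : ∀ (n : ℕ) ω, r n ω ^ 2 ≤ ((n : ℝ) ^ 3)⁻¹ *
      (2 * (∑ q ∈ (Finset.range n).offDiag, f (X q.1 ω) (X q.2 ω)) ^ 2 + 8 * (n * C) ^ 2) := by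
    intro n ω
    rw [hsum, mul_pow]
    have h1 : (((n : ℝ) * √n)⁻¹) ^ 2 = ((n : ℝ) ^ 3)⁻¹ := by
      rw [inv_pow, mul_pow, Real.sq_sqrt (by positivity)]; ring
    rw [h1]
    refine mul_le_mul_of_nonneg_left ?_ (by positivity)
    have h2 := sq_le_sq.2 ((hgb n ω).trans (le_abs_self _))
    nlinarith [sq_nonneg (∑ q ∈ (Finset.range n).offDiag, f (X q.1 ω) (X q.2 ω)
      + 2 * ∑ i ∈ Finset.range n, g₁ (X i ω))]
  have hrm : ∀ n, AEMeasurable (r n) Q := fun n => by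
    rw [show r n = _ from funext (hsum n)]
    exact ((hfm n).sub ((hgm n).const_mul 2)).const_mul _
  have hbi : ∀ n : ℕ, Integrable (fun ω => ((n : ℝ) ^ 3)⁻¹ *
      (2 * (∑ q ∈ (Finset.range n).offDiag, f (X q.1 ω) (X q.2 ω)) ^ 2 + 8 * (n * C) ^ 2)) Q :=
    fun n => (((hfint n).const_mul 2).add (integrable_const _)).const_mul _
  have hri : ∀ n, Integrable (fun ω => r n ω ^ 2) Q := fun n =>
    (hbi n).mono' ((hrm n).pow_const 2).aestronglyMeasurable (ae_of_all _ fun ω => by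
      rw [Real.norm_of_nonneg (sq_nonneg _)]; exact hle n ω)
  refine ⟨hri, ?_⟩
  -- By `(a - 2b)² ≤ 2a² + 8b²`, the degenerate part contributes `2 · 2 · (3C)² n² = 36 C² n²` and
  -- the mismatch `8 C² n²`. Dividing the total by `n³` leaves `44 C² / n`.
  have hlim : Tendsto (fun n : ℕ => 44 * C ^ 2 * (n : ℝ)⁻¹) atTop (𝓝 0) := by
    simpa using (tendsto_inv_atTop_nhds_zero_nat (𝕜 := ℝ)).const_mul (44 * C ^ 2)
  refine squeeze_zero (fun n => integral_nonneg fun ω => sq_nonneg _) (fun n => ?_) hlim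
  refine (integral_mono (hri n) (hbi n) (hle n)).trans ?_
  rw [integral_const_mul, integral_add ((hfint n).const_mul 2) (integrable_const _),
    integral_const_mul, integral_const]
  have h2 := integral_sq_sum_offDiag_le hlaw hindep hf hfC hf1 hf2 n
  rcases Nat.eq_zero_or_pos n with rfl | hn
  · simp
  have hn' : (0 : ℝ) < n := by positivity
  rw [inv_mul_le_iff₀ (by positivity)]
  have : (n : ℝ) ^ 3 * (44 * C ^ 2 * (n : ℝ)⁻¹) = 44 * C ^ 2 * n ^ 2 := by field_simp
  rw [this]
  simp only [probReal_univ, one_smul]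
  linarith

end UStatistic

/-! ### Population quantities: the kernel, the influence functions and their covariance. -/

section PopulationLemmas

variable {p r m : ℕ}

theorem measurableSet_inBox {B : Set (Fin r → ℝ)} (hB : MeasurableSet B) :
    MeasurableSet (inBox p B) := measurable_snd hB

theorem measurable_indicator_inBox {B : Set (Fin r → ℝ)} (hB : MeasurableSet B) :
    Measurable ((inBox p B).indicator (1 : Obs p r → ℝ)) :=
  measurable_one.indicator (measurableSet_inBox hB)

theorem indicator_inBox_mul (B B' : Set (Fin r → ℝ)) (x : Obs p r) :
    (inBox p B).indicator (1 : Obs p r → ℝ) x * (inBox p B').indicator 1 x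
      = (inBox p (B ∩ B')).indicator 1 x := by
  by_cases h : x.2 ∈ B <;> by_cases h' : x.2 ∈ B' <;> simp [inBox, h, h']

theorem abs_indicator_inBox_le (B : Set (Fin r → ℝ)) (x : Obs p r) :
    |(inBox p B).indicator (1 : Obs p r → ℝ) x| ≤ 1 := by
  by_cases h : x ∈ inBox p B <;> simp [h]

theorem concKernel_symm (a b : Fin p) (x y : Obs p r) :
    concKernel a b x y = concKernel a b y x := by
  simp only [concKernel, add_comm]

theorem measurableSet_lt_lt (a b : Fin p) :
    MeasurableSet {z : Obs p r × Obs p r | z.1.1 a < z.2.1 a ∧ z.1.1 b < z.2.1 b} :=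
  MeasurableSet.inter
    (measurableSet_lt (f := fun z : Obs p r × Obs p r => z.1.1 a) (g := fun z => z.2.1 a)
      (by fun_prop) (by fun_prop))
    (measurableSet_lt (f := fun z : Obs p r × Obs p r => z.1.1 b) (g := fun z => z.2.1 b)
      (by fun_prop) (by fun_prop))

theorem measurable_concKernel (a b : Fin p) :
    Measurable (Function.uncurry (concKernel (r := r) a b)) :=
  ((Measurable.ite (measurableSet_lt_lt a b) measurable_const measurable_const).add
    (Measurable.ite (measurable_swap (measurableSet_lt_lt a b))
      measurable_const measurable_const)).div_const 2

theorem abs_concKernel_le (a b : Fin p) (x y : Obs p r) : |concKernel a b x y| ≤ 1 := by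
  unfold concKernel
  split_ifs <;> norm_num

variable (P : Measure (Obs p r))

theorem integral_indicator_mul_eq {B : Set (Fin r → ℝ)} (hB : MeasurableSet B)
    (hpos : 0 < boxProb P B) (f : Obs p r → ℝ) :
    ∫ x, (inBox p B).indicator 1 x * f x ∂P = boxProb P B * ∫ x, f x ∂(condLaw P B) := by
  have h : ∀ x, (inBox p B).indicator 1 x * f x = (inBox p B).indicator f x := fun x => by
    by_cases hx : x ∈ inBox p B <;> simp [hx]
  simp_rw [h]
  rw [integral_indicator (measurableSet_inBox hB), condLaw, ProbabilityTheory.cond,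
    integral_smul_measure, smul_eq_mul, ENNReal.toReal_inv]
  change _ = boxProb P B * ((boxProb P B)⁻¹ * _)
  rw [mul_inv_cancel_left₀ hpos.ne']

theorem integral_indicator_inBox {B : Set (Fin r → ℝ)} (hB : MeasurableSet B) :
    ∫ x, (inBox p B).indicator (1 : Obs p r → ℝ) x ∂P = boxProb P B :=
  integral_indicator_one (measurableSet_inBox hB)

/-- The conditional expectation of `π_{a,b}(X, x)` given `X_J ∈ B`. -/
noncomputable def projKernel (B : Set (Fin r → ℝ)) (a b : Fin p) (x : Obs p r) : ℝ :=
  ∫ y, concKernel a b y x ∂(condLaw P B)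

/-- The probability that `X₁` is smaller than `X₂` in the coordinates `a` and `b`, given that
`X_{1,J}` and `X_{2,J}` are in `A_k`. -/
noncomputable def condConc (A : Fin m → Set (Fin r → ℝ)) (a b : Fin p) (k : Fin m) : ℝ :=
  D P A a b k / boxProb P (A k) ^ 2

variable {P} {A : Fin m → Set (Fin r → ℝ)}

/-- The kernel of the U-statistic that governs the error of the conditional Kendall's tau. -/
noncomputable def tauKernel (P : Measure (Obs p r)) (A : Fin m → Set (Fin r → ℝ))
    (s : Pairs p × Fin m) (x y : Obs p r) : ℝ :=
  (inBox p (A s.2)).indicator 1 x * ((inBox p (A s.2)).indicator 1 y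
    * (concKernel s.1.1.1 s.1.1.2 x y - condConc P A s.1.1.1 s.1.1.2 s.2))

/-- The influence function of the empirical conditional Kendall's tau. -/
noncomputable def score (P : Measure (Obs p r)) (A : Fin m → Set (Fin r → ℝ)) (s : Pairs p × Fin m)
    (x : Obs p r) : ℝ :=
  8 / boxProb P (A s.2) * ((inBox p (A s.2)).indicator 1 x
    * (projKernel P (A s.2) s.1.1.1 s.1.1.2 x - condConc P A s.1.1.1 s.1.1.2 s.2))

theorem tauKernel_symm (s : Pairs p × Fin m) (x y : Obs p r) :
    tauKernel P A s x y = tauKernel P A s y x := by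
  simp only [tauKernel, concKernel_symm _ _ x y]; ring

theorem measurable_tauKernel (hA : ∀ k, MeasurableSet (A k)) (s : Pairs p × Fin m) :
    Measurable (Function.uncurry (tauKernel P A s)) :=
  ((measurable_indicator_inBox (hA _)).comp measurable_fst).mul
    (((measurable_indicator_inBox (hA _)).comp measurable_snd).mul
      ((measurable_concKernel _ _).sub_const _))

theorem abs_tauKernel_le (s : Pairs p × Fin m) (x y : Obs p r) :
    |tauKernel P A s x y| ≤ 1 + |condConc P A s.1.1.1 s.1.1.2 s.2| := by
  have h1 := abs_indicator_inBox_le (A s.2) x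
  have h2 := abs_indicator_inBox_le (A s.2) y
  have h3 := abs_concKernel_le s.1.1.1 s.1.1.2 x y
  rw [tauKernel, abs_mul, abs_mul]
  calc _ ≤ 1 * (1 * |concKernel s.1.1.1 s.1.1.2 x y - condConc P A s.1.1.1 s.1.1.2 s.2|) := by
        gcongr
    _ ≤ _ := by rw [one_mul, one_mul]; exact (abs_sub _ _).trans (by gcongr)

variable [IsProbabilityMeasure P]

theorem isProbabilityMeasure_condLaw {B : Set (Fin r → ℝ)} (hpos : 0 < boxProb P B) :
    IsProbabilityMeasure (condLaw P B) :=
  cond_isProbabilityMeasure fun h => hpos.ne' (by simp [boxProb, measureReal_def, h])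

theorem measurable_projKernel {B : Set (Fin r → ℝ)} (hpos : 0 < boxProb P B) (a b : Fin p) :
    Measurable (projKernel P B a b) := by
  have := isProbabilityMeasure_condLaw hpos
  exact (StronglyMeasurable.integral_prod_right (f := fun x y => concKernel a b y x)
    ((measurable_concKernel (r := r) a b).comp measurable_swap).stronglyMeasurable).measurable

theorem abs_projKernel_le {B : Set (Fin r → ℝ)} (hpos : 0 < boxProb P B) (a b : Fin p)
    (x : Obs p r) : |projKernel P B a b x| ≤ 1 := by
  have := isProbabilityMeasure_condLaw hpos
  simpa [projKernel] using norm_integral_le_of_norm_le_const (μ := condLaw P B)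
    (f := fun y => concKernel a b y x) (C := 1) (ae_of_all _ fun y => abs_concKernel_le a b y x)

/-- The product of the conditional laws is `P ⊗ P` restricted to both draws in the box, divided by
the squared box probability. -/
theorem condLaw_prod_real_lt_lt (a b : Fin p) (k : Fin m) :
    ((condLaw P (A k)).prod (condLaw P (A k))).real
      {z | z.1.1 a < z.2.1 a ∧ z.1.1 b < z.2.1 b} = condConc P A a b k := by
  rw [condConc, D, condLaw, ProbabilityTheory.cond, Measure.prod_smul_left, Measure.prod_smul_right,
    Measure.prod_restrict, measureReal_ennreal_smul_apply, measureReal_ennreal_smul_apply,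
    measureReal_restrict_apply (measurableSet_lt_lt a b), ENNReal.toReal_inv]
  change (boxProb P (A k))⁻¹ * ((boxProb P (A k))⁻¹ * _) = _
  rw [show ({z : Obs p r × Obs p r | z.1.1 a < z.2.1 a ∧ z.1.1 b < z.2.1 b}
      ∩ inBox p (A k) ×ˢ inBox p (A k))
    = {z | z.1.1 a < z.2.1 a ∧ z.1.1 b < z.2.1 b ∧ z.1.2 ∈ A k ∧ z.2.2 ∈ A k} by
      ext z; simp [inBox, and_assoc]]
  ring

theorem condLaw_prod_real_gt_gt (hpos : ∀ k, 0 < boxProb P (A k))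
    (a b : Fin p) (k : Fin m) :
    ((condLaw P (A k)).prod (condLaw P (A k))).real
      {z | z.2.1 a < z.1.1 a ∧ z.2.1 b < z.1.1 b} = condConc P A a b k := by
  have := isProbabilityMeasure_condLaw (hpos k)
  rw [← condLaw_prod_real_lt_lt a b k, measureReal_def, measureReal_def,
    ← (Measure.measurePreserving_swap (μ := condLaw P (A k))
      (ν := condLaw P (A k))).measure_preimage (measurableSet_lt_lt a b).nullMeasurableSet]
  rfl

/-- `concKernel` averages the indicators of two events that are exchanged by swapping the draws, and
both have probability `condConc`. -/
theorem integral_projKernel (hpos : ∀ k, 0 < boxProb P (A k))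
    (a b : Fin p) (k : Fin m) :
    ∫ x, projKernel P (A k) a b x ∂(condLaw P (A k)) = condConc P A a b k := by
  have := isProbabilityMeasure_condLaw (hpos k)
  let M := (condLaw P (A k)).prod (condLaw P (A k))
  have hS := measurableSet_lt_lt (r := r) a b
  have hS' : MeasurableSet {z : Obs p r × Obs p r | z.2.1 a < z.1.1 a ∧ z.2.1 b < z.1.1 b} :=
    measurable_swap hS
  have hi : Integrable (Function.uncurry (concKernel (r := r) a b)) M :=
    integrable_of_abs_le (measurable_concKernel a b).aemeasurable
      (C := 1) fun z => abs_concKernel_le a b z.1 z.2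
  have h1 : ∫ x, projKernel P (A k) a b x ∂(condLaw P (A k))
      = ∫ z, Function.uncurry (concKernel a b) z ∂M := by
    rw [integral_prod_symm _ hi]; rfl
  have h2 : ∀ z : Obs p r × Obs p r, Function.uncurry (concKernel a b) z
      = (Set.indicator {z | z.1.1 a < z.2.1 a ∧ z.1.1 b < z.2.1 b} (1 : Obs p r × Obs p r → ℝ) z
        + Set.indicator {z | z.2.1 a < z.1.1 a ∧ z.2.1 b < z.1.1 b} 1 z) / 2 := fun z => by
    simp [Function.uncurry, concKernel, Set.indicator_apply]
  rw [h1]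
  simp_rw [h2]
  have hi1 : ∀ {S : Set (Obs p r × Obs p r)}, MeasurableSet S →
      Integrable (S.indicator (1 : Obs p r × Obs p r → ℝ)) M := fun h =>
    (integrable_const (1 : ℝ)).indicator h
  rw [integral_div, integral_add (hi1 hS) (hi1 hS'), integral_indicator_one hS,
    integral_indicator_one hS', condLaw_prod_real_lt_lt, condLaw_prod_real_gt_gt hpos]
  ring

/-- The mass of an atom is the jump of the distribution function. -/
theorem nullSingletonClass_of_continuous_cdf (μ : Measure ℝ) [IsProbabilityMeasure μ]
    (h : Continuous (cdf μ)) : NullSingletonClass μ where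
  measure_singleton x := by
    rw [← measure_cdf μ, StieltjesFunction.measure_singleton,
      h.continuousAt.continuousWithinAt.leftLim_eq]
    simp

/-- By Fubini: for a fixed first draw, a tie puts the other coordinate at a single point, which the
continuous margin does not charge. -/
theorem condLaw_prod_tie_eq_zero (hpos : ∀ k, 0 < boxProb P (A k))
    (hcont : ∀ k a, Continuous (cdf (condMargin P (A k) a))) (a : Fin p) (k : Fin m) :
    ((condLaw P (A k)).prod (condLaw P (A k))) {z | z.1.1 a = z.2.1 a} = 0 := by
  have := isProbabilityMeasure_condLaw (hpos k)
  have hm : Measurable fun x : Obs p r => x.1 a := by fun_prop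
  have : IsProbabilityMeasure (condMargin P (A k) a) :=
    Measure.isProbabilityMeasure_map hm.aemeasurable
  have := nullSingletonClass_of_continuous_cdf _ (hcont k a)
  have hS : MeasurableSet {z : Obs p r × Obs p r | z.1.1 a = z.2.1 a} :=
    measurableSet_eq_fun (by fun_prop) (by fun_prop)
  rw [Measure.measure_prod_null hS]
  refine ae_of_all _ fun x => ?_
  have := measure_singleton (μ := condMargin P (A k) a) (x.1 a)
  rw [condMargin, Measure.map_apply hm (measurableSet_singleton _)] at this
  simpa [Set.preimage, eq_comm] using this

/-- Concordance is two disjoint events of probability `θ` each. Ties being null, discordance has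
probability `1 - 2θ`. -/
theorem tau_eq (hpos : ∀ k, 0 < boxProb P (A k))
    (hcont : ∀ k a, Continuous (cdf (condMargin P (A k) a))) (a b : Fin p) (k : Fin m) :
    tau P (A k) a b = 4 * condConc P A a b k - 1 := by
  have := isProbabilityMeasure_condLaw (hpos k)
  let M := (condLaw P (A k)).prod (condLaw P (A k))
  have hS := measurableSet_lt_lt (r := r) a b
  have hS' : MeasurableSet {z : Obs p r × Obs p r | z.2.1 a < z.1.1 a ∧ z.2.1 b < z.1.1 b} :=
    measurable_swap hS
  let f : Obs p r × Obs p r → ℝ := fun z => (z.1.1 a - z.2.1 a) * (z.1.1 b - z.2.1 b)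
  have hf : Measurable f := by fun_prop
  have hconc : M.real {z | 0 < f z} = 2 * condConc P A a b k := by
    have : {z | 0 < f z} = {z : Obs p r × Obs p r | z.1.1 a < z.2.1 a ∧ z.1.1 b < z.2.1 b}
        ∪ {z | z.2.1 a < z.1.1 a ∧ z.2.1 b < z.1.1 b} := by
      ext z
      simp only [Set.mem_ofPred_eq, Set.mem_union, f, mul_pos_iff, sub_pos, sub_neg]
      tauto
    rw [this, measureReal_union _ hS', condLaw_prod_real_lt_lt, condLaw_prod_real_gt_gt hpos]
    · ring
    · exact Set.disjoint_left.2 fun z h h' => lt_asymm h.1 h'.1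
  have htie : M.real {z | f z = 0} = 0 := by
    have h0 : M {z | f z = 0} = 0 := by
      refine measure_mono_null (t := {z | z.1.1 a = z.2.1 a} ∪ {z | z.1.1 b = z.2.1 b}) ?_
        (measure_union_null (condLaw_prod_tie_eq_zero hpos hcont a k)
          (condLaw_prod_tie_eq_zero hpos hcont b k))
      intro z hz
      simpa [f, sub_eq_zero] using hz
    simp [measureReal_def, h0]
  have htot : M.real {z | 0 < f z} + M.real {z | f z < 0} = 1 := by
    have h1 : MeasurableSet {z | 0 < f z} := measurableSet_lt measurable_const hf
    have h2 : MeasurableSet {z | f z < 0} := measurableSet_lt hf measurable_const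
    have h3 : MeasurableSet {z | f z = 0} := hf (measurableSet_singleton 0)
    have hd : Disjoint {z | 0 < f z} {z | f z < 0} :=
      Set.disjoint_left.2 fun z (h : 0 < f z) h' => lt_asymm h h'
    rw [← measureReal_union hd h2]
    have hu : {z | 0 < f z} ∪ {z | f z < 0} = {z | f z = 0}ᶜ := by
      ext z
      simp only [Set.mem_union, Set.mem_ofPred_eq, Set.mem_compl_iff]
      rw [or_comm, ← ne_eq, ne_iff_lt_or_gt]
    rw [hu, measureReal_compl h3, htie]
    simp [M]
  change M.real {z | 0 < f z} - M.real {z | f z < 0} = _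
  linarith

theorem measurable_score (hA : ∀ k, MeasurableSet (A k)) (hpos : ∀ k, 0 < boxProb P (A k))
    (s : Pairs p × Fin m) : Measurable (score P A s) :=
  ((measurable_indicator_inBox (hA _)).mul
    ((measurable_projKernel (hpos _) _ _).sub_const _)).const_mul _

theorem abs_score_le (hpos : ∀ k, 0 < boxProb P (A k)) (s : Pairs p × Fin m) (x : Obs p r) :
    |score P A s x|
      ≤ 8 / boxProb P (A s.2) * (1 + |condConc P A s.1.1.1 s.1.1.2 s.2|) := by
  have h1 := abs_indicator_inBox_le (A s.2) x
  have h3 := abs_projKernel_le (hpos s.2) s.1.1.1 s.1.1.2 x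
  have := hpos s.2
  rw [score, abs_mul, abs_mul, abs_of_pos (by positivity)]
  gcongr
  calc _ ≤ 1 * |projKernel P (A s.2) s.1.1.1 s.1.1.2 x - condConc P A s.1.1.1 s.1.1.2 s.2| := by
        gcongr
    _ ≤ _ := by rw [one_mul]; exact (abs_sub _ _).trans (by gcongr)

/-- Identifies the Hájek projection of an entry of `uStat`. The factor `2` comes from the two
arguments of the symmetric kernel, and passing to the conditional law releases one box probability,
which leaves `8 / p_k`. -/
theorem integral_tauKernel (hA : ∀ k, MeasurableSet (A k)) (hpos : ∀ k, 0 < boxProb P (A k))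
    (s : Pairs p × Fin m) (x : Obs p r) :
    4 / boxProb P (A s.2) ^ 2 * (2 * ∫ y, tauKernel P A s x y ∂P) = score P A s x := by
  have := isProbabilityMeasure_condLaw (hpos s.2)
  have hp := (hpos s.2).ne'
  have hi : Integrable (fun y => concKernel s.1.1.1 s.1.1.2 x y) (condLaw P (A s.2)) :=
    integrable_of_abs_le ((measurable_concKernel _ _).comp measurable_prodMk_left).aemeasurable
      (abs_concKernel_le _ _ x)
  have : ∫ y, concKernel s.1.1.1 s.1.1.2 x y ∂(condLaw P (A s.2))
      = projKernel P (A s.2) s.1.1.1 s.1.1.2 x := by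
    simp only [projKernel, concKernel_symm _ _ x]
  simp only [tauKernel, score]
  rw [integral_const_mul, integral_indicator_mul_eq P (hA _) (hpos _),
    integral_sub hi (integrable_const _), this, integral_const]
  simp only [probReal_univ, one_smul]
  field_simp
  ring

theorem integral_score (hA : ∀ k, MeasurableSet (A k)) (hpos : ∀ k, 0 < boxProb P (A k))
    (s : Pairs p × Fin m) : ∫ x, score P A s x ∂P = 0 := by
  have := isProbabilityMeasure_condLaw (hpos s.2)
  simp only [score]
  rw [integral_const_mul, integral_indicator_mul_eq P (hA _) (hpos _),
    integral_sub (integrable_of_abs_le (measurable_projKernel (hpos _) _ _).aemeasurable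
      (abs_projKernel_le (hpos _) _ _)) (integrable_const _),
    integral_projKernel hpos, integral_const]
  simp

theorem integral_integral_tauKernel (hA : ∀ k, MeasurableSet (A k))
    (hpos : ∀ k, 0 < boxProb P (A k)) (s : Pairs p × Fin m) :
    ∫ x, ∫ y, tauKernel P A s x y ∂P ∂P = 0 := by
  have hp := (hpos s.2).ne'
  have h := integral_score hA hpos s
  simp only [← integral_tauKernel hA hpos s, integral_const_mul] at h
  simpa [hp] using h

/-- With `x₃` fixed, the integrals over `x₁` and `x₂` separate into two projections. -/
theorem bigI_eq (hA : ∀ k, MeasurableSet (A k)) (hpos : ∀ k, 0 < boxProb P (A k))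
    (a b a' b' : Fin p) (k l : Fin m) :
    bigI P A a b a' b' k l = ∫ x, (inBox p (A k ∩ A l)).indicator 1 x
      * (projKernel P (A k) a b x * projKernel P (A l) a' b' x) ∂P := by
  have := isProbabilityMeasure_condLaw (hpos k)
  have := isProbabilityMeasure_condLaw (hpos l)
  have hB := measurable_indicator_inBox (p := p) ((hA k).inter (hA l))
  have hbound : ∀ x y z : Obs p r, |(inBox p (A k ∩ A l)).indicator (1 : Obs p r → ℝ) z
      * concKernel a b x z * concKernel a' b' y z| ≤ 1 := fun x y z => by
    rw [abs_mul, abs_mul]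
    exact mul_le_one₀ (mul_le_one₀ (abs_indicator_inBox_le _ _) (abs_nonneg _)
      (abs_concKernel_le _ _ _ _)) (abs_nonneg _) (abs_concKernel_le _ _ _ _)
  have hm : Measurable fun z : Obs p r × Obs p r × Obs p r =>
      (inBox p (A k ∩ A l)).indicator (1 : Obs p r → ℝ) z.2.2
        * concKernel a b z.1 z.2.2 * concKernel a' b' z.2.1 z.2.2 :=
    ((hB.comp (measurable_snd.comp measurable_snd)).mul ((measurable_concKernel a b).comp
      (measurable_fst.prodMk (measurable_snd.comp measurable_snd)))).mul
      ((measurable_concKernel a' b').comp measurable_snd)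
  rw [bigI, integral_prod_symm _
    (integrable_of_abs_le hm.aemeasurable fun z => hbound z.1 z.2.1 z.2.2)]
  simp only [mul_assoc, integral_const_mul, integral_mul_const]
  have hm2 : Measurable fun z : Obs p r × Obs p r => (inBox p (A k ∩ A l)).indicator 1 z.2
      * (projKernel P (A k) a b z.2 * concKernel a' b' z.1 z.2) :=
    (hB.comp measurable_snd).mul (((measurable_projKernel (hpos k) a b).comp measurable_snd).mul
      (measurable_concKernel a' b'))
  have hb2 : ∀ z : Obs p r × Obs p r, |(inBox p (A k ∩ A l)).indicator 1 z.2
      * (projKernel P (A k) a b z.2 * concKernel a' b' z.1 z.2)| ≤ 1 := fun z => by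
    rw [abs_mul, abs_mul]
    exact mul_le_one₀ (abs_indicator_inBox_le _ _) (by positivity) (mul_le_one₀
      (abs_projKernel_le (hpos k) a b _) (abs_nonneg _) (abs_concKernel_le _ _ _ _))
  change ∫ z : Obs p r × Obs p r, (inBox p (A k ∩ A l)).indicator 1 z.2
      * (projKernel P (A k) a b z.2 * concKernel a' b' z.1 z.2) ∂_ = _
  rw [integral_prod_symm _ (integrable_of_abs_le hm2.aemeasurable hb2)]
  simp only [integral_const_mul]
  rfl

theorem bigJ_eq (hA : ∀ k, MeasurableSet (A k)) (hpos : ∀ k, 0 < boxProb P (A k))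
    (a b : Fin p) (k l : Fin m) :
    bigJ P A a b k l
      = ∫ x, (inBox p (A k ∩ A l)).indicator 1 x * projKernel P (A k) a b x ∂P := by
  have := isProbabilityMeasure_condLaw (hpos k)
  have hB := measurable_indicator_inBox (p := p) ((hA k).inter (hA l))
  have hm : Measurable fun z : Obs p r × Obs p r =>
      (inBox p (A k ∩ A l)).indicator (1 : Obs p r → ℝ) z.2 * concKernel a b z.1 z.2 :=
    (hB.comp measurable_snd).mul (measurable_concKernel a b)
  rw [bigJ, integral_prod_symm _ (integrable_of_abs_le (C := 1) hm.aemeasurable fun z => by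
      rw [abs_mul]
      exact mul_le_one₀ (abs_indicator_inBox_le _ _) (abs_nonneg _) (abs_concKernel_le _ _ _ _))]
  simp only [integral_const_mul]
  rfl

/-- `Δ_e` is the covariance matrix of the influence functions. -/
theorem integral_score_mul_score (hA : ∀ k, MeasurableSet (A k))
    (hpos : ∀ k, 0 < boxProb P (A k)) (s t : Pairs p × Fin m) :
    ∫ x, score P A s x * score P A t x ∂P = Delta P A s t := by
  obtain ⟨⟨⟨a, b⟩, hab⟩, k⟩ := s
  obtain ⟨⟨⟨a', b'⟩, hab'⟩, l⟩ := t
  have hk := (hpos k).ne'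
  have hl := (hpos l).ne'
  let u : Obs p r → ℝ := (inBox p (A k ∩ A l)).indicator 1
  let f := projKernel P (A k) a b
  let g := projKernel P (A l) a' b'
  have hu : Measurable u := measurable_indicator_inBox ((hA k).inter (hA l))
  have hf : Measurable f := measurable_projKernel (hpos k) a b
  have hg : Measurable g := measurable_projKernel (hpos l) a' b'
  have huC : ∀ x, |u x| ≤ 1 := abs_indicator_inBox_le _
  have hfC : ∀ x, |f x| ≤ 1 := abs_projKernel_le (hpos k) a b
  have hgC : ∀ x, |g x| ≤ 1 := abs_projKernel_le (hpos l) a' b'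
  have hui : Integrable u P := integrable_of_abs_le hu.aemeasurable huC
  have huf : Integrable (fun x => u x * f x) P :=
    integrable_of_abs_le (hu.mul hf).aemeasurable (C := 1) fun x => by
      rw [abs_mul]; exact mul_le_one₀ (huC x) (abs_nonneg _) (hfC x)
  have hug : Integrable (fun x => u x * g x) P :=
    integrable_of_abs_le (hu.mul hg).aemeasurable (C := 1) fun x => by
      rw [abs_mul]; exact mul_le_one₀ (huC x) (abs_nonneg _) (hgC x)
  have hufg : Integrable (fun x => u x * (f x * g x)) P :=
    integrable_of_abs_le (hu.mul (hf.mul hg)).aemeasurable (C := 1) fun x => by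
      rw [abs_mul, abs_mul]
      exact mul_le_one₀ (huC x) (by positivity) (mul_le_one₀ (hfC x) (abs_nonneg _) (hgC x))
  have hI : bigI P A a b a' b' k l = ∫ x, u x * (f x * g x) ∂P := bigI_eq hA hpos _ _ _ _ _ _
  have hJ : bigJ P A a b k l = ∫ x, u x * f x ∂P := bigJ_eq hA hpos _ _ _ _
  have hJ' : bigJ P A a' b' l k = ∫ x, u x * g x ∂P := by
    rw [bigJ_eq hA hpos, Set.inter_comm]
  have hU : boxProb P (A k ∩ A l) = ∫ x, u x ∂P :=
    (integral_indicator_inBox P ((hA k).inter (hA l))).symm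
  let θ := condConc P A a b k
  let θ' := condConc P A a' b' l
  -- The indicators multiply to that of `A_k ∩ A_l`, and the two factors `8` give the `64` of
  -- `Delta`. The four terms integrate to `I`, the two `J`'s and `p_{k,l}`; substituting `θ = D /
  -- p_k²` yields the powers of `p_k` and `p_l`.
  have hprod : ∀ x, score P A ((⟨(a, b), hab⟩, k) : Pairs p × Fin m) x
      * score P A ((⟨(a', b'), hab'⟩, l) : Pairs p × Fin m) x
      = 64 / (boxProb P (A k) * boxProb P (A l)) * (u x * (f x * g x) - θ' * (u x * f x)
        - θ * (u x * g x) + θ * θ' * u x) := fun x => by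
    simp only [score, u, ← indicator_inBox_mul, f, g, θ, θ']
    ring
  simp_rw [hprod]
  have h1 : Integrable (fun x => u x * (f x * g x) - θ' * (u x * f x)) P :=
    hufg.sub (huf.const_mul _)
  have h2 : Integrable (fun x => u x * (f x * g x) - θ' * (u x * f x) - θ * (u x * g x)) P :=
    h1.sub (hug.const_mul _)
  rw [integral_const_mul, integral_add h2 (hui.const_mul _), integral_sub h1 (hug.const_mul _),
    integral_sub hufg (huf.const_mul _), integral_const_mul, integral_const_mul,
    integral_const_mul, ← hI, ← hJ, ← hJ', ← hU]
  simp only [Delta, Matrix.of_apply, θ, θ', condConc]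
  field_simp
  ring

/-- A Gram matrix: the quadratic form at `v` is the second moment of the combination `∑ v s * score
s`. -/
theorem posSemidef_Delta (hA : ∀ k, MeasurableSet (A k)) (hpos : ∀ k, 0 < boxProb P (A k)) :
    (Delta P A).PosSemidef := by
  refine Matrix.PosSemidef.of_dotProduct_mulVec_nonneg ?_ fun v => ?_
  · ext s t
    simp only [Matrix.conjTranspose_apply, star_trivial, ← integral_score_mul_score hA hpos,
      mul_comm]
  · have hi : ∀ s t, Integrable (fun x => v s * (score P A s x * score P A t x * v t)) P :=
      fun s t => ((integrable_of_abs_le ((measurable_score hA hpos s).mul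
        (measurable_score hA hpos t)).aemeasurable fun x => by
          rw [Pi.mul_apply, abs_mul]
          exact mul_le_mul (abs_score_le hpos s x) (abs_score_le hpos t x) (abs_nonneg _)
            ((abs_nonneg _).trans (abs_score_le hpos s x))).mul_const _).const_mul _
    have : star v ⬝ᵥ Delta P A *ᵥ v = ∫ x, (∑ s, v s * score P A s x) ^ 2 ∂P := by
      have hsq : ∀ x, (∑ s, v s * score P A s x) ^ 2
          = ∑ s, ∑ t, v s * (score P A s x * score P A t x * v t) := fun x => by
        rw [sq, Finset.sum_mul_sum]
        exact Finset.sum_congr rfl fun s _ => Finset.sum_congr rfl fun t _ => by ring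
      simp_rw [hsq]
      rw [integral_finsetSum _ fun s _ => integrable_finsetSum _ fun t _ => hi s t]
      simp only [dotProduct, Matrix.mulVec, Finset.mul_sum, star_trivial]
      refine Finset.sum_congr rfl fun s _ => ?_
      rw [integral_finsetSum _ fun t _ => hi s t]
      exact Finset.sum_congr rfl fun t _ => by
        rw [integral_const_mul, integral_mul_const, integral_score_mul_score hA hpos]
    rw [this]
    exact integral_nonneg fun x => sq_nonneg _

end PopulationLemmas

/-- Fibred over the larger index `b`, there are `b` choices of the smaller one. -/
theorem card_pairs (p : ℕ) : Fintype.card (Pairs p) = p * (p - 1) / 2 := by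
  have e : Pairs p ≃ Σ b : Fin p, Fin b.val :=
    { toFun := fun q => ⟨q.1.2, ⟨q.1.1.val, q.2⟩⟩
      invFun := fun s => ⟨(⟨s.2.val, s.2.2.trans s.1.2⟩, s.1), s.2.2⟩
      left_inv := fun _ => rfl
      right_inv := fun _ => rfl }
  rw [Fintype.card_congr e, Fintype.card_sigma]
  simp only [Fintype.card_fin]
  rw [Fin.sum_univ_eq_sum_range (fun i => i) p, Finset.sum_range_id]

/-! ### Exact algebra of the estimator for a fixed sample. -/

section SampleLemmas

variable {p r m : ℕ} {P : Measure (Obs p r)} {A : Fin m → Set (Fin r → ℝ)}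

theorem subSize_eq_sum_range (n : ℕ) (y : ℕ → Obs p r) (B : Set (Fin r → ℝ)) :
    subSize (fun i : Fin n => y i) B
      = ∑ i ∈ Finset.range n, (inBox p B).indicator (1 : Obs p r → ℝ) (y i) := by
  rw [subSize, Finset.sum_range fun i => (inBox p B).indicator (1 : Obs p r → ℝ) (y i)]

theorem indicator_mul_self (B : Set (Fin r → ℝ)) (x : Obs p r) :
    (inBox p B).indicator (1 : Obs p r → ℝ) x * (inBox p B).indicator 1 x
      = (inBox p B).indicator 1 x := by
  rw [indicator_inBox_mul, Set.inter_self]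

/-- Indicators are idempotent, so the sum is `N / N²`. For `N = 0` both sides are `0` by convention.
-/
theorem sumSqWeight_eq {n : ℕ} (x : Fin n → Obs p r) (B : Set (Fin r → ℝ)) :
    sumSqWeight x B = (subSize x B)⁻¹ := by
  simp only [sumSqWeight, weight, sq, div_mul_div_comm, indicator_mul_self]
  rw [← Finset.sum_div]
  change subSize x B / (subSize x B * subSize x B) = _
  rw [div_self_mul_self']

theorem sum_tauKernel_eq (s : Pairs p × Fin m) (n : ℕ) (y : ℕ → Obs p r) :
    ∑ q ∈ (Finset.range n).offDiag, tauKernel P A s (y q.1) (y q.2)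
      = ∑ i : Fin n, ∑ j : Fin n, (inBox p (A s.2)).indicator 1 (y i)
          * (inBox p (A s.2)).indicator 1 (y j)
          * (if (y i).1 s.1.1.1 < (y j).1 s.1.1.1 ∧ (y i).1 s.1.1.2 < (y j).1 s.1.1.2
              then 1 else 0)
        - condConc P A s.1.1.1 s.1.1.2 s.2 * (subSize (fun i : Fin n => y i) (A s.2)
          * (subSize (fun i : Fin n => y i) (A s.2) - 1)) := by
  rw [sum_offDiag_eq _ fun i j => tauKernel P A s (y i) (y j)]
  let u : ℕ → ℝ := fun i => (inBox p (A s.2)).indicator 1 (y i)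
  let c : ℕ → ℕ → ℝ := fun i j =>
    if (y i).1 s.1.1.1 < (y j).1 s.1.1.1 ∧ (y i).1 s.1.1.2 < (y j).1 s.1.1.2 then 1 else 0
  let θ := condConc P A s.1.1.1 s.1.1.2 s.2
  have hu : ∀ i, u i * u i = u i := fun i => indicator_mul_self _ _
  -- The strict inequalities make the diagonal of `c` vanish. The diagonal of the kernel is then
  -- only the centering term, which turns `N²` into `N(N - 1)`.
  have hc : ∀ i, c i i = 0 := fun i => by simp [c]
  have hk : ∀ i j, tauKernel P A s (y i) (y j)
      = u i * u j * c i j / 2 + u j * u i * c j i / 2 - θ * (u i * u j) := fun i j => by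
    simp only [tauKernel, concKernel, u, c, θ]; ring
  have hdiag : ∑ i ∈ Finset.range n, tauKernel P A s (y i) (y i)
      = - (θ * ∑ i ∈ Finset.range n, u i) := by
    simp only [hk, hc, hu, mul_zero, zero_div, add_zero, zero_sub, Finset.sum_neg_distrib,
      Finset.mul_sum]
  have hsub : subSize (fun i : Fin n => y i) (A s.2) = ∑ i ∈ Finset.range n, u i :=
    subSize_eq_sum_range n y _
  have hfull : ∑ i ∈ Finset.range n, ∑ j ∈ Finset.range n, tauKernel P A s (y i) (y j)
      = ∑ i ∈ Finset.range n, ∑ j ∈ Finset.range n, u i * u j * c i j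
        - θ * ((∑ i ∈ Finset.range n, u i) * ∑ i ∈ Finset.range n, u i) := by
    -- Over all ordered pairs, the symmetrized kernel and the one-sided indicator have the same sum.
    have hswap : ∑ i ∈ Finset.range n, ∑ j ∈ Finset.range n, u j * u i * c j i / 2
        = ∑ i ∈ Finset.range n, ∑ j ∈ Finset.range n, u i * u j * c i j / 2 := Finset.sum_comm
    simp only [hk, Finset.sum_sub_distrib, Finset.sum_add_distrib]
    rw [hswap, Finset.sum_mul_sum]
    simp only [← Finset.sum_div, ← Finset.mul_sum]
    ring
  have hfin : ∑ i ∈ Finset.range n, ∑ j ∈ Finset.range n, u i * u j * c i j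
      = ∑ i : Fin n, ∑ j : Fin n, u i * u j * c i j := by
    rw [Finset.sum_range fun i => ∑ j ∈ Finset.range n, u i * u j * c i j]
    exact Finset.sum_congr rfl fun i _ => Finset.sum_range fun j => u i * u j * c i j
  rw [hfull, hdiag, hfin, hsub]
  ring

theorem measurable_waldStat (hA : ∀ k, MeasurableSet (A k)) (n : ℕ) :
    Measurable fun x : Fin n → Obs p r => waldStat P A x := by
  have hu : ∀ k i, Measurable fun x : Fin n → Obs p r =>
      (inBox p (A k)).indicator (1 : Obs p r → ℝ) (x i) := fun k i =>
    (measurable_indicator_inBox (hA k)).comp (measurable_pi_apply i)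
  have hN : ∀ k, Measurable fun x : Fin n → Obs p r => subSize x (A k) := fun k =>
    Finset.measurable_fun_sum _ fun i _ => hu k i
  have hw : ∀ k i, Measurable fun x : Fin n → Obs p r => weight x (A k) i := fun k i =>
    (hu k i).div (hN k)
  have hs : ∀ k, Measurable fun x : Fin n → Obs p r => sumSqWeight x (A k) := fun k =>
    Finset.measurable_fun_sum _ fun i _ => (hw k i).pow_const 2
  have hτ1 : ∀ k a b, Measurable fun x : Fin n → Obs p r => tauHat1 x (A k) a b := fun k a b =>
    ((Finset.measurable_fun_sum _ fun i _ => Finset.measurable_fun_sum _ fun j _ =>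
      ((hw k i).mul (hw k j)).mul (Measurable.ite
        (((measurable_pi_apply i).prodMk (measurable_pi_apply j)) (measurableSet_lt_lt a b))
        measurable_const measurable_const)).const_mul 4).sub_const 1
  have hW : Measurable fun x : Fin n → Obs p r => W P A x := measurable_pi_iff.2 fun s =>
    (((hτ1 _ _ _).div (measurable_const.sub (hs _))).add
      ((hs _).div (measurable_const.sub (hs _)))).sub_const _
  have hq : Continuous fun w : Pairs p × Fin m → ℝ => (contrastE p m *ᵥ w) ⬝ᵥ
      (contrastE p m * Delta P A * (contrastE p m)ᵀ)⁻¹ *ᵥ (contrastE p m *ᵥ w) := by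
    fun_prop
  exact (hq.measurable.comp hW).const_mul _

variable [IsProbabilityMeasure P]

/-- The error of the empirical conditional Kendall's tau is a U-statistic, up to normalization. -/
theorem W_eq (hpos : ∀ k, 0 < boxProb P (A k))
    (hcont : ∀ k a, Continuous (cdf (condMargin P (A k) a))) (s : Pairs p × Fin m) (n : ℕ)
    (y : ℕ → Obs p r) (h0 : subSize (fun i : Fin n => y i) (A s.2) ≠ 0)
    (h1 : subSize (fun i : Fin n => y i) (A s.2) ≠ 1) :
    W P A (fun i : Fin n => y i) s
      = 4 / (subSize (fun i : Fin n => y i) (A s.2)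
          * (subSize (fun i : Fin n => y i) (A s.2) - 1))
        * ∑ q ∈ (Finset.range n).offDiag, tauKernel P A s (y q.1) (y q.2) := by
  have h1' : subSize (fun i : Fin n => y i) (A s.2) - 1 ≠ 0 := sub_ne_zero.2 h1
  have hN : 1 - (subSize (fun i : Fin n => y i) (A s.2))⁻¹
      = (subSize (fun i : Fin n => y i) (A s.2) - 1) / subSize (fun i : Fin n => y i) (A s.2) := by
    field_simp
  have htau1 : tauHat1 (fun i : Fin n => y i) (A s.2) s.1.1.1 s.1.1.2
      = 4 * ((∑ i : Fin n, ∑ j : Fin n, (inBox p (A s.2)).indicator 1 (y i)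
          * (inBox p (A s.2)).indicator 1 (y j)
          * (if (y i).1 s.1.1.1 < (y j).1 s.1.1.1 ∧ (y i).1 s.1.1.2 < (y j).1 s.1.1.2
              then 1 else 0)) / subSize (fun i : Fin n => y i) (A s.2) ^ 2) - 1 := by
    simp only [tauHat1, weight, Finset.sum_div]
    congr 2
    exact Finset.sum_congr rfl fun i _ => Finset.sum_congr rfl fun j _ => by ring
  rw [sum_tauKernel_eq, W, tauHat, sumSqWeight_eq, tau_eq hpos hcont, htau1, hN]
  field_simp
  ring

end SampleLemmas

/-! ### Limit in law of the normalized U-statistic vector and of the subsample sizes. -/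

section Asymptotics

theorem tendstoInDistribution_id_of_map_eq {Ω Ω' E : Type*} {mΩ : MeasurableSpace Ω}
    {mΩ' : MeasurableSpace Ω'} [TopologicalSpace E] [MeasurableSpace E] [OpensMeasurableSpace E]
    {Q : Measure Ω} [IsProbabilityMeasure Q] {μ : Measure Ω'} [IsProbabilityMeasure μ]
    {ν : Measure E} [IsProbabilityMeasure ν] {X : ℕ → Ω → E} {Z : Ω' → E} {l : Filter ℕ}
    (h : TendstoInDistribution X l Z (fun _ => Q) μ) (hZ : μ.map Z = ν) :
    TendstoInDistribution X l id (fun _ => Q) ν where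
  forall_aemeasurable := h.forall_aemeasurable
  aemeasurable_limit := aemeasurable_id
  tendsto := by
    have hlim := h.tendsto
    have heq : (⟨μ.map Z, Measure.isProbabilityMeasure_map h.aemeasurable_limit⟩ :
        ProbabilityMeasure E) = ⟨ν.map id, Measure.isProbabilityMeasure_map aemeasurable_id⟩ :=
      Subtype.ext (by simp [hZ])
    rwa [heq] at hlim

variable {p r m : ℕ} {P : Measure (Obs p r)} {A : Fin m → Set (Fin r → ℝ)} {Ω : Type*}
  {mΩ : MeasurableSpace Ω} {Q : Measure Ω} {X : ℕ → Ω → Obs p r}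

/-- The vector of normalized U-statistics with kernels `tauKernel`. -/
noncomputable def uStat (P : Measure (Obs p r)) (A : Fin m → Set (Fin r → ℝ)) (n : ℕ)
    (y : ℕ → Obs p r) : EuclideanSpace ℝ (Pairs p × Fin m) :=
  WithLp.toLp 2 fun s => 4 / boxProb P (A s.2) ^ 2 * (((n : ℝ) * √n)⁻¹ *
    ∑ q ∈ (Finset.range n).offDiag, tauKernel P A s (y q.1) (y q.2))

/-- The normalization that turns `uStat` into the vector of estimation errors. -/
noncomputable def sizeRatio (P : Measure (Obs p r)) (A : Fin m → Set (Fin r → ℝ)) (n : ℕ)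
    (y : ℕ → Obs p r) (k : Fin m) : ℝ :=
  boxProb P (A k) ^ 2 * n ^ 2 / (subSize (fun i : Fin n => y i) (A k)
    * (subSize (fun i : Fin n => y i) (A k) - 1))

theorem aemeasurable_sizeRatio (hX : ∀ i, AEMeasurable (X i) Q)
    (hA : ∀ k, MeasurableSet (A k)) (n : ℕ) :
    AEMeasurable (fun ω => sizeRatio P A n fun i => X i ω) Q := by
  refine aemeasurable_pi_iff.2 fun k => ?_
  have hN : AEMeasurable (fun ω => subSize (fun i : Fin n => X i ω) (A k)) Q :=
    Finset.aemeasurable_fun_sum _ fun i _ =>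
      (measurable_indicator_inBox (hA k)).comp_aemeasurable (hX i)
  exact aemeasurable_const.div (hN.mul (hN.sub_const 1))

/-- Keeps the sample away from `N ≤ 1`, where a denominator vanishes. -/
theorem eventually_two_le_of_tendsto_div {N : ℕ → ℝ} {c : ℝ} (hc : 0 < c)
    (h : Tendsto (fun n : ℕ => N n / n) atTop (𝓝 c)) : ∀ᶠ n in atTop, 2 ≤ N n := by
  have hN : Tendsto N atTop atTop := by
    refine (h.pos_mul_atTop hc tendsto_natCast_atTop_atTop).congr' ?_
    filter_upwards [eventually_gt_atTop 0] with n hn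
    field_simp
  exact hN.eventually_ge_atTop 2

theorem aemeasurable_uStat (hX : ∀ i, AEMeasurable (X i) Q) (hA : ∀ k, MeasurableSet (A k))
    (n : ℕ) : AEMeasurable (fun ω => uStat P A n fun i => X i ω) Q := by
  have h : ∀ s (q : ℕ × ℕ), AEMeasurable (fun ω => tauKernel P A s (X q.1 ω) (X q.2 ω)) Q :=
    fun s q => (measurable_tauKernel hA s).comp_aemeasurable ((hX q.1).prodMk (hX q.2))
  have h' : ∀ s, AEMeasurable (fun ω => 4 / boxProb P (A s.2) ^ 2 * (((n : ℝ) * √n)⁻¹ *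
      ∑ q ∈ (Finset.range n).offDiag, tauKernel P A s (X q.1 ω) (X q.2 ω))) Q := fun s =>
    ((Finset.aemeasurable_fun_sum _ fun q _ => h s q).const_mul _).const_mul _
  exact (WithLp.measurable_toLp 2 _).comp_aemeasurable (aemeasurable_pi_iff.2 h')

variable [IsProbabilityMeasure Q]

theorem ae_tendsto_subSize_div (hlaw : ∀ i, HasLaw (X i) P Q) (hindep : iIndepFun X Q)
    (hA : ∀ k, MeasurableSet (A k)) :
    ∀ᵐ ω ∂Q, ∀ k, Tendsto (fun n : ℕ => subSize (fun i : Fin n => X i ω) (A k) / n) atTop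
      (𝓝 (boxProb P (A k))) := by
  refine ae_all_iff.2 fun k => ?_
  have hX : ∀ i, AEMeasurable (X i) Q := fun i => (hlaw i).aemeasurable
  have hu := measurable_indicator_inBox (p := p) (hA k)
  have h := strong_law_ae_real (fun i ω => (inBox p (A k)).indicator (1 : Obs p r → ℝ) (X i ω))
    (integrable_of_abs_le (hu.comp_aemeasurable (hX 0)) fun ω => abs_indicator_inBox_le _ _)
    (fun i j hij => (hindep.indepFun hij).comp hu hu)
    (fun i => ((hlaw i).identDistrib (hlaw 0)).comp hu)
  have hmean : ∫ ω, (inBox p (A k)).indicator (1 : Obs p r → ℝ) (X 0 ω) ∂Q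
      = boxProb P (A k) := by
    rw [← integral_indicator_inBox P (hA k), ← (hlaw 0).map_eq,
      integral_map (hX 0) hu.aestronglyMeasurable]
  rw [hmean] at h
  filter_upwards [h] with ω hω
  simpa only [subSize_eq_sum_range _ fun i => X i ω] using hω

/-- After division by `n²`, the denominator is `(N/n)(N/n - 1/n)`, which tends to `p_k²` by the
strong law. -/
theorem ae_tendsto_sizeRatio (hlaw : ∀ i, HasLaw (X i) P Q) (hindep : iIndepFun X Q)
    (hA : ∀ k, MeasurableSet (A k)) (hpos : ∀ k, 0 < boxProb P (A k)) :
    ∀ᵐ ω ∂Q, Tendsto (fun n => sizeRatio P A n fun i => X i ω) atTop (𝓝 1) := by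
  filter_upwards [ae_tendsto_subSize_div hlaw hindep hA] with ω hω
  refine tendsto_pi_nhds.2 fun k => ?_
  have hp := (hpos k).ne'
  have h1 : Tendsto (fun n : ℕ => boxProb P (A k) ^ 2
      / (subSize (fun i : Fin n => X i ω) (A k) / n
        * (subSize (fun i : Fin n => X i ω) (A k) / n - (n : ℝ)⁻¹))) atTop (𝓝 1) := by
    have := (tendsto_const_nhds (x := boxProb P (A k) ^ 2)).div
      ((hω k).mul ((hω k).sub (tendsto_inv_atTop_nhds_zero_nat (𝕜 := ℝ))))
      (by simpa using hp)
    rwa [sub_zero, ← sq, div_self (pow_ne_zero 2 hp)] at this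
  refine h1.congr' ?_
  filter_upwards [eventually_gt_atTop 0] with n hn
  have hn' : (n : ℝ) ≠ 0 := by positivity
  rw [sizeRatio, ← mul_div_mul_right _ _ (pow_ne_zero 2 hn')]
  congr 1
  field_simp

variable [IsProbabilityMeasure P]

theorem tendstoInDistribution_sum_score (hlaw : ∀ i, HasLaw (X i) P Q) (hindep : iIndepFun X Q)
    (hA : ∀ k, MeasurableSet (A k)) (hpos : ∀ k, 0 < boxProb P (A k)) :
    TendstoInDistribution (fun (n : ℕ) ω => (√n)⁻¹ • ∑ k ∈ Finset.range n,
        (WithLp.toLp 2 fun s => score P A s (X k ω) : EuclideanSpace ℝ (Pairs p × Fin m)))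
      atTop id (fun _ => Q) (multivariateGaussian 0 (Delta P A)) := by
  have hX : ∀ i, AEMeasurable (X i) Q := fun i => (hlaw i).aemeasurable
  let v : Obs p r → EuclideanSpace ℝ (Pairs p × Fin m) := fun x =>
    WithLp.toLp 2 fun s => score P A s x
  have hv : Measurable v :=
    (WithLp.measurable_toLp 2 _).comp (measurable_pi_iff.2 fun s => measurable_score hA hpos s)
  refine tendstoInDistribution_multivariateGaussian (V := fun i ω => v (X i ω))
    (posSemidef_Delta hA hpos) (hindep.comp (fun _ => v) fun _ => hv)
    (fun i => ((hlaw i).identDistrib (hlaw 0)).comp hv) (fun s => ?_) (fun s => ?_) fun s t => ?_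
  · exact MemLp.of_bound ((measurable_score hA hpos s).comp_aemeasurable
      (hX 0)).aestronglyMeasurable _ (ae_of_all _ fun ω => abs_score_le hpos s (X 0 ω))
  · rw [← integral_score hA hpos s]
    exact (hlaw 0).integral_comp (measurable_score hA hpos s).aestronglyMeasurable
  · rw [← integral_score_mul_score hA hpos s t]
    exact (hlaw 0).integral_comp (f := fun x => score P A s x * score P A t x)
      ((measurable_score hA hpos s).mul (measurable_score hA hpos t)).aestronglyMeasurable

theorem tendstoInMeasure_uStat_sub (hlaw : ∀ i, HasLaw (X i) P Q) (hindep : iIndepFun X Q)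
    (hA : ∀ k, MeasurableSet (A k)) (hpos : ∀ k, 0 < boxProb P (A k)) :
    TendstoInMeasure Q (fun (n : ℕ) ω => (uStat P A n fun i => X i ω)
      - (√n)⁻¹ • ∑ k ∈ Finset.range n,
        (WithLp.toLp 2 fun s => score P A s (X k ω) : EuclideanSpace ℝ (Pairs p × Fin m)))
      atTop 0 := by
  have hrem := fun s => hajek_remainder hlaw hindep (measurable_tauKernel hA s)
    (abs_tauKernel_le s) (tauKernel_symm s) (integral_integral_tauKernel hA hpos s)
  let R : Pairs p × Fin m → ℕ → Ω → ℝ := fun s n ω => ((n : ℝ) * √n)⁻¹ *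
    ∑ q ∈ (Finset.range n).offDiag, tauKernel P A s (X q.1 ω) (X q.2 ω)
      - (√n)⁻¹ * ∑ i ∈ Finset.range n, 2 * ∫ y, tauKernel P A s (X i ω) y ∂P
  let c : Pairs p × Fin m → ℝ := fun s => (4 / boxProb P (A s.2) ^ 2) ^ 2
  have hR : ∀ s n, Integrable (fun ω => R s n ω ^ 2) Q := fun s => (hrem s).1
  have hR0 : ∀ s, Tendsto (fun n => ∫ ω, R s n ω ^ 2 ∂Q) atTop (𝓝 0) := fun s => (hrem s).2
  -- Each coordinate of the difference is a constant times a scalar Hájek remainder, so finitely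
  -- many scalar bounds control the norm.
  have hnorm : ∀ (n : ℕ) ω, ‖(uStat P A n fun i => X i ω) - (√n)⁻¹ • ∑ k ∈ Finset.range n,
      (WithLp.toLp 2 fun s => score P A s (X k ω) : EuclideanSpace ℝ (Pairs p × Fin m))‖ ^ 2
      = ∑ s, c s * R s n ω ^ 2 := by
    intro n ω
    rw [EuclideanSpace.real_norm_sq_eq]
    refine Finset.sum_congr rfl fun s _ => ?_
    rw [← mul_pow, mul_sub]
    congr 1
    simp only [PiLp.sub_apply, uStat, PiLp.smul_apply, WithLp.ofLp_sum,
      Finset.sum_apply, smul_eq_mul]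
    congr 1
    rw [mul_left_comm]
    congr 1
    rw [Finset.mul_sum]
    exact Finset.sum_congr rfl fun i _ => (integral_tauKernel hA hpos s (X i ω)).symm
  refine tendstoInMeasure_zero_of_tendsto_integral_sq (fun n => ?_) ?_
  · exact (integrable_finsetSum _ fun s _ => (hR s n).const_mul (c s)).congr
      (ae_of_all _ fun ω => (hnorm n ω).symm)
  · have : ∀ n : ℕ, ∫ ω, ∑ s, c s * R s n ω ^ 2 ∂Q = ∑ s, c s * ∫ ω, R s n ω ^ 2 ∂Q := fun n => by
      rw [integral_finsetSum _ fun s _ => (hR s n).const_mul _]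
      simp only [integral_const_mul]
    have h := tendsto_finsetSum (Finset.univ : Finset (Pairs p × Fin m)) fun s _ =>
      (hR0 s).const_mul (c s)
    simp only [mul_zero, Finset.sum_const_zero] at h
    refine h.congr fun n => ?_
    rw [← this]
    exact integral_congr_ae (ae_of_all _ fun ω => (hnorm n ω).symm)

theorem tendstoInDistribution_uStat (hlaw : ∀ i, HasLaw (X i) P Q) (hindep : iIndepFun X Q)
    (hA : ∀ k, MeasurableSet (A k)) (hpos : ∀ k, 0 < boxProb P (A k)) :
    TendstoInDistribution (fun n ω => uStat P A n fun i => X i ω) atTop id (fun _ => Q)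
      (multivariateGaussian 0 (Delta P A)) := by
  let Y : ℕ → Ω → EuclideanSpace ℝ (Pairs p × Fin m) := fun n ω => uStat P A n fun i => X i ω
  let S : ℕ → Ω → EuclideanSpace ℝ (Pairs p × Fin m) := fun n ω =>
    (√n)⁻¹ • ∑ k ∈ Finset.range n, WithLp.toLp 2 fun s => score P A s (X k ω)
  have hsub : TendstoInMeasure Q (Y - S) atTop 0 :=
    tendstoInMeasure_uStat_sub hlaw hindep hA hpos
  exact tendstoInDistribution_of_tendstoInMeasure_sub Y id
    (tendstoInDistribution_sum_score hlaw hindep hA hpos) hsub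
    (aemeasurable_uStat (fun i => (hlaw i).aemeasurable) hA)

/-- The Wald statistic as a function of `uStat` and `sizeRatio`. -/
theorem waldStat_eq (hpos : ∀ k, 0 < boxProb P (A k))
    (hcont : ∀ k a, Continuous (cdf (condMargin P (A k) a))) {n : ℕ} (hn : 0 < n)
    {y : ℕ → Obs p r} (h : ∀ k, 2 ≤ subSize (fun i : Fin n => y i) (A k)) :
    waldStat P A (fun i : Fin n => y i)
      = (contrastE p m *ᵥ fun s => sizeRatio P A n y s.2 * uStat P A n y s) ⬝ᵥ
        (contrastE p m * Delta P A * (contrastE p m)ᵀ)⁻¹ *ᵥ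
          (contrastE p m *ᵥ fun s => sizeRatio P A n y s.2 * uStat P A n y s) := by
  have hn' : (0 : ℝ) < n := by positivity
  -- The box probabilities cancel, and `n² / (n√n) = √n`; the two factors `√n` in the quadratic form
  -- make up the factor `n` of the statistic.
  have hW : (fun s => sizeRatio P A n y s.2 * uStat P A n y s)
      = √n • W P A (fun i : Fin n => y i) := by
    ext s
    have h2 := h s.2
    have hp := (hpos s.2).ne'
    have h0 : subSize (fun i : Fin n => y i) (A s.2) ≠ 0 := by linarith
    have h1 : subSize (fun i : Fin n => y i) (A s.2) - 1 ≠ 0 := by linarith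
    rw [Pi.smul_apply, smul_eq_mul, W_eq hpos hcont s n y h0 (sub_ne_zero.1 h1)]
    simp only [sizeRatio, uStat]
    have hs : √(n : ℝ) ≠ 0 := by positivity
    have hss : √(n : ℝ) ^ 2 = n := Real.sq_sqrt hn'.le
    field_simp
    rw [hss]
  rw [hW, Matrix.mulVec_smul, Matrix.mulVec_smul, smul_dotProduct, dotProduct_smul, smul_smul,
    Real.mul_self_sqrt hn'.le]
  rfl

end Asymptotics

end CondKendall

/-! ### Slutsky's lemma and the chi-squared limit. -/

theorem mainTheorem6 {Ω : Type*} [MeasurableSpace Ω] (Q : MeasureTheory.Measure Ω)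
    [MeasureTheory.IsProbabilityMeasure Q] (p r m : ℕ)
    -- the law `P` of the observations and the i.i.d. sequence `X` with this law
    (P : MeasureTheory.Measure (CondKendall.Obs p r)) [MeasureTheory.IsProbabilityMeasure P]
    (X : ℕ → Ω → CondKendall.Obs p r)
    (hlaw : ∀ i, ProbabilityTheory.HasLaw (X i) P Q)
    (hindep : ProbabilityTheory.iIndepFun X Q)
    -- the conditioning sets
    (A : Fin m → Set (Fin r → ℝ))
    (hA : ∀ k, MeasurableSet (A k))
    (hpos : ∀ k, 0 < CondKendall.boxProb P (A k))
    -- the conditional margins are continuous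
    (hcont : ∀ k a, Continuous (ProbabilityTheory.cdf (CondKendall.condMargin P (A k) a)))
    -- the limiting Gaussian law is non-degenerate
    (hreg : IsUnit (CondKendall.contrastE p m * CondKendall.Delta P A
      * (CondKendall.contrastE p m).transpose))
    -- the null hypothesis
    (hnull : ∀ k l : Fin m, ∀ a b : Fin p, a < b →
      CondKendall.tau P (A k) a b = CondKendall.tau P (A l) a b) :
    MeasureTheory.TendstoInDistribution
      (fun (n : ℕ) ω => CondKendall.waldStat P A (fun i : Fin n => X i ω))
      Filter.atTop id (fun _ => Q)
      (CondKendall.chiSquared ((m - 1) * (p * (p - 1) / 2))) := by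
  open CondKendall Filter Topology Matrix in
  have hX : ∀ i, AEMeasurable (X i) Q := fun i => (hlaw i).aemeasurable
  let T := contrastE p m
  let q : EuclideanSpace ℝ (Pairs p × Fin m) × (Fin m → ℝ) → ℝ := fun z =>
    (T *ᵥ fun s => z.2 s.2 * z.1 s) ⬝ᵥ (T * Delta P A * Tᵀ)⁻¹ *ᵥ (T *ᵥ fun s => z.2 s.2 * z.1 s)
  have hq : Continuous q := by fun_prop
  have hstat : ∀ n : ℕ, AEMeasurable (fun ω => waldStat P A (fun i : Fin n => X i ω)) Q :=
    fun n => (measurable_waldStat hA n).comp_aemeasurable (aemeasurable_pi_iff.2 fun i => hX i)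
  have hratio := aemeasurable_sizeRatio (P := P) hX hA
  -- Slutsky: `uStat` converges in law and `sizeRatio` in probability to the constant vector `1`, so
  -- the continuous `q` may be applied to the pair.
  have hlim := (tendstoInDistribution_uStat hlaw hindep hA hpos
    ).continuous_comp_prodMk_of_tendstoInMeasure_const hq (c := 1)
    (tendstoInMeasure_of_tendsto_ae (fun n => (hratio n).aestronglyMeasurable)
      (ae_tendsto_sizeRatio hlaw hindep hA hpos)) hratio
  -- Almost every path has all subsample sizes at least `2` from some random index on. From then on
  -- the statistic equals `q` exactly, so the difference is eventually zero.
  have hsub : TendstoInMeasure Q ((fun (n : ℕ) ω => waldStat P A (fun i : Fin n => X i ω))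
      - fun n ω => q (uStat P A n fun i => X i ω, sizeRatio P A n fun i => X i ω)) atTop 0 := by
    refine tendstoInMeasure_of_tendsto_ae
      (fun n => ((hstat n).sub (hlim.forall_aemeasurable n)).aestronglyMeasurable) ?_
    filter_upwards [ae_tendsto_subSize_div hlaw hindep hA] with ω hω
    refine tendsto_const_nhds.congr' ?_
    filter_upwards [eventually_gt_atTop 0, eventually_all.2 fun k =>
      eventually_two_le_of_tendsto_div (hpos k) (hω k)] with n hn hN
    exact (sub_eq_zero.2 (waldStat_eq (y := fun i => X i ω) hpos hcont hn hN)).symm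
  refine tendstoInDistribution_id_of_map_eq
    (tendstoInDistribution_of_tendstoInMeasure_sub _ _ hlim hsub hstat) ?_
  have hcard : Fintype.card (Pairs p × Fin (m - 1)) = (m - 1) * (p * (p - 1) / 2) := by
    rw [Fintype.card_prod, card_pairs, Fintype.card_fin, mul_comm]
  rw [← map_sum_sq_eq_chiSquared hcard,
    ← multivariateGaussian_map_quadForm (posSemidef_Delta hA hpos) T hreg]
  simp only [q, id, Pi.one_apply, one_mul]
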